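/- Let $N\ge 1$ and let $\Omega\subseteq\mathbb R^N$ be a bounded open set with Lipschitz boundary. Let $\varphi\colon\mathbb R^N\times\mathbb R^N\to[0,\infty)$ be a Borel function with $\varphi(x,t\xi)=t\varphi(x,\xi)$ for all $t\ge 0$ and $x,\xi\in\mathbb R^N$, and with $\alpha|\xi|\le\varphi(x,\xi)\le\beta|\xi|$ for all $x,\xi$ and some constants $0<\alpha\le\beta<\infty$ (neither convexity nor continuity is assumed). Set $\widetilde\varphi(x,\xi):=\varphi(x,-\xi)$. For $w\in BV_{loc}(\mathbb R^N)$ and a Borel set $B\subseteq\mathbb R^N$ put $$|Dw|_\varphi(B):=\int_B\varphi\Big(x,\tfrac{dDw}{d|Dw|}(x)\Big)\,d|Dw|(x),$$ and for measurable $A\subseteq\mathbb R^N$ put $P_\varphi(A):=|D\mathbf 1_A|_\varphi(\mathbb R^N)$ if $A$ has locally finite perimeter in $\mathbb R^N$, and $P_\varphi(A):=\infty$ otherwise. For measurable $A\subseteq\mathbb R^N$ let $A^1$ be the set of points at which $A$ has density $1$, and $A^+$ the set of points at which $A$ has positive upper density. For measurable $w\colon\Omega\to\mathbb R$ and $x\in\Omega$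 let $$w^+(x):=\sup\{t\in\mathbb R: x\in\{w>t\}^+\},\qquad w^-(x):=\sup\{t\in\mathbb R: x\in\{w>t\}^1\}.$$ Let $\mu_+,\mu_-$ be non-negative Radon measures on $\Omega$ (not necessarily mutually singular) such that $\mu_\pm(Z)=0$ for every Borel set $Z\subseteq\Omega$ with $\mathcal H^{N-1}(Z)=0$, and $\int_\Omega v^+\,d\mu_\pm<\infty$ for every non-negative $v\in BV(\Omega)$ (in particular, $\mu_+$ and $\mu_-$ are finite). Let $u_0\in W^{1,1}(\mathbb R^N)$. For $w\in BV(\Omega)$ let $\overline w:=w\mathbf 1_\Omega+u_0\mathbf 1_{\mathbb R^N\setminus\overline\Omega}\in BV(\mathbb R^N)$ and $$\widehat\Phi[w]:=|D\overline w|_\varphi(\overline\Omega)+\int_\Omega w^-\,d\mu_+-\int_\Omega w^+\,d\mu_-.$$ If $\widehat\Phi$ is bounded from below on $BV(\Omega)$, then for every measurable set $A$ whose closure is a compact subset of $\Omega$, $$\mu_-(A^+)-\mu_+(A^1)\le P_\varphi(A)\qquad\text{and}\qquad \mu_+(A^+)-\mu_-(A^1)\le P_{\widetilde\varphi}(A);$$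 that is, $(\mu_-,\mu_+)$ satisfies the $\varphi$-isoperimetric condition and $(\mu_+,\mu_-)$ satisfies the $\widetilde\varphi$-isoperimetric condition in $\Omega$, both with constant $1$. -/

import Mathlib

open MeasureTheory Filter Topology
open scoped ENNReal NNReal RealInnerProductSpace

noncomputable section

namespace AnisoBV

/-- The Euclidean space `ℝ^N`. -/
abbrev Euc (N : ℕ) : Type := EuclideanSpace ℝ (Fin N)

variable {N : ℕ}

/-! ### Domains and densities -/

/-- `Ω` has Lipschitz boundary: near each boundary point it is, for a suitable unit vector `e`,
the strict epigraph in direction `e` of a Lipschitz function of the component orthogonal to `e`. -/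
def HasLipschitzBoundary (Ω : Set (Euc N)) : Prop :=
  ∀ x ∈ frontier Ω, ∃ (e : Euc N) (V : Set (Euc N)) (g : Euc N → ℝ) (K : ℝ≥0),
    ‖e‖ = 1 ∧ IsOpen V ∧ x ∈ V ∧ LipschitzWith K g ∧
      Ω ∩ V = {y | y ∈ V ∧ g (y - ⟪e, y⟫ • e) < ⟪e, y⟫}

/-- Compact containment `A ⋐ U`. -/
def CompactlyContained (A U : Set (Euc N)) : Prop :=
  IsCompact (closure A) ∧ closure A ⊆ U

/-- The volume fraction `|B_r(x) ∩ A| / |B_r(x)|`. -/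
def volumeFraction (A : Set (Euc N)) (x : Euc N) (r : ℝ) : ℝ≥0∞ :=
  volume (Metric.ball x r ∩ A) / volume (Metric.ball x r)

/-- The measure-theoretic interior `A¹`, the set of points of density one. -/
def measureInterior (A : Set (Euc N)) : Set (Euc N) :=
  {x | Tendsto (volumeFraction A x) (𝓝[>] 0) (𝓝 1)}

/-- The measure-theoretic closure `A⁺`, the set of points of positive upper density. -/
def measureClosure (A : Set (Euc N)) : Set (Euc N) :=
  {x | 0 < limsup (volumeFraction A x) (𝓝[>] 0)}

/-- The approximate upper limit `u⁺(x) = sup {t : x ∈ {u > t}⁺}` of `u : U → ℝ`. -/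
def approxUpper (U : Set (Euc N)) (u : Euc N → ℝ) (x : Euc N) : EReal :=
  sSup ((fun t : ℝ => (t : EReal)) '' {t | x ∈ measureClosure {y | y ∈ U ∧ t < u y}})

/-- The approximate lower limit `u⁻(x) = sup {t : x ∈ {u > t}¹}` of `u : U → ℝ`. -/
def approxLower (U : Set (Euc N)) (u : Euc N → ℝ) (x : Euc N) : EReal :=
  sSup ((fun t : ℝ => (t : EReal)) '' {t | x ∈ measureInterior {y | y ∈ U ∧ t < u y}})

/-! ### `W^{1,1}` and `BV` -/

/-- `u ∈ W^{1,1}(ℝ^N)`: `u` is integrable and has an integrable weak gradient `G`. -/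
def MemW11 (u : Euc N → ℝ) : Prop :=
  Integrable u volume ∧ ∃ G : Euc N → Euc N, Integrable G volume ∧
    ∀ η : Euc N → ℝ, ContDiff ℝ (⊤ : ℕ∞) η → HasCompactSupport η → ∀ v : Euc N,
      ∫ x, u x * fderiv ℝ η x v = -∫ x, η x * ⟪G x, v⟫

/-- The distributional gradient of `u` on the open set `U` is the `ℝ^N`-valued Radon measure
`Du = ν ρ` in polar form: `ρ = |Du|` is a Radon measure on `U` (extended by zero to `ℝ^N`),
`ν = dDu/d|Du|` has length one `ρ`-a.e., and `∫_U u ∂_v η dx = -∫_U η (ν · v) dρ` for all test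
functions `η ∈ C_c^∞(U)` and directions `v`. The pair `(ρ, ν)` is unique up to changing `ν` on a
`ρ`-negligible set. -/
structure HasPolarGradient (U : Set (Euc N)) (u : Euc N → ℝ)
    (ρ : Measure (Euc N)) (ν : Euc N → Euc N) : Prop where
  compl_eq_zero : ρ Uᶜ = 0
  lt_top_of_isCompact : ∀ K : Set (Euc N), IsCompact K → K ⊆ U → ρ K < ⊤
  measurable : Measurable ν
  norm_eq_one : ∀ᵐ x ∂ρ, ‖ν x‖ = 1
  integral_eq : ∀ η : Euc N → ℝ, ContDiff ℝ (⊤ : ℕ∞) η → HasCompactSupport η → tsupport η ⊆ U →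
    ∀ v : Euc N, ∫ x in U, u x * fderiv ℝ η x v = -∫ x, η x * ⟪ν x, v⟫ ∂ρ

/-- `u ∈ BV(U)`: `u ∈ L¹(U)` and the distributional gradient of `u` is a measure with finite total
variation `|Du|(U)`. Only the values of `u` on `U` matter. -/
def MemBV (U : Set (Euc N)) (u : Euc N → ℝ) : Prop :=
  IntegrableOn u U volume ∧ ∃ ρ ν, HasPolarGradient U u ρ ν ∧ ρ U < ⊤

/-! ### Anisotropic total variation and perimeter -/

/-- Admissible integrands: non-negative Borel functions `φ(x, ξ)` which are positively
`1`-homogeneous in `ξ` and comparable to the Euclidean norm of `ξ`. -/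
structure IsAdmissibleIntegrand (φ : Euc N → Euc N → ℝ) : Prop where
  measurable : Measurable (Function.uncurry φ)
  nonneg : ∀ x ξ, 0 ≤ φ x ξ
  homogeneous : ∀ (t : ℝ), 0 ≤ t → ∀ x ξ, φ x (t • ξ) = t * φ x ξ
  comparable : ∃ α β : ℝ, 0 < α ∧ α ≤ β ∧ ∀ x ξ, α * ‖ξ‖ ≤ φ x ξ ∧ φ x ξ ≤ β * ‖ξ‖

/-- The mirrored integrand `φ̃(x, ξ) = φ(x, -ξ)`. -/
def mirrored (φ : Euc N → Euc N → ℝ) : Euc N → Euc N → ℝ := fun x ξ => φ x (-ξ)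

/-- The `φ`-anisotropic total variation `|Du|_φ(B) = ∫_B φ(x, dDu/d|Du|) d|Du|` of `u ∈ BV_loc(ℝ^N)`
on `B`. All polar forms of `Du` give the same value of the integral, so that the infimum just
selects this value; if `u` is not in `BV_loc(ℝ^N)`, the infimum runs over the empty set and gives
the conventional value `∞`. -/
def anisoTV (φ : Euc N → Euc N → ℝ) (u : Euc N → ℝ) (B : Set (Euc N)) : ℝ≥0∞ :=
  ⨅ (ρ : Measure (Euc N)) (ν : Euc N → Euc N)
    (_ : LocallyIntegrable u volume ∧ HasPolarGradient Set.univ u ρ ν),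
      ∫⁻ x in B, ENNReal.ofReal (φ x (ν x)) ∂ρ

/-- The `φ`-anisotropic perimeter `P_φ(A) = |D𝟙_A|_φ(ℝ^N)`, equal to `∞` if `A` does not have
(locally) finite perimeter. -/
def anisoPerimeter (φ : Euc N → Euc N → ℝ) (A : Set (Euc N)) : ℝ≥0∞ :=
  anisoTV φ (A.indicator fun _ => (1 : ℝ)) Set.univ

/-! ### Measures, isoperimetric conditions, and the functional -/

/-- Admissible measures: `μ` is a non-negative Radon measure on `Ω` (extended by zero to `ℝ^N`)
which vanishes on `H^{N-1}`-negligible Borel subsets of `Ω` and satisfies `∫_Ω v⁺ dμ < ∞` for all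
non-negative `v ∈ BV(Ω)`. -/
structure IsAdmissibleMeasure (Ω : Set (Euc N)) (μ : Measure (Euc N)) : Prop where
  compl_eq_zero : μ Ωᶜ = 0
  lt_top_of_isCompact : ∀ K : Set (Euc N), IsCompact K → K ⊆ Ω → μ K < ⊤
  hausdorff_null : ∀ Z : Set (Euc N), MeasurableSet Z → Z ⊆ Ω →
    μH[(N : ℝ) - 1] Z = 0 → μ Z = 0
  lintegral_lt_top : ∀ v : Euc N → ℝ, MemBV Ω v → (∀ᵐ x ∂(volume.restrict Ω), 0 ≤ v x) →
    ∫⁻ x in Ω, (approxUpper Ω v x).toENNReal ∂μ < ⊤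

/-- The pair `(μ, ν)` of finite measures on `U` satisfies the `φ`-anisotropic isoperimetric condition
in `U` with constant `C`: `μ(A⁺) - ν(A¹) ≤ C P_φ(A)` for all measurable `A ⋐ U`. As `ν` is finite,
its term may be moved to the right-hand side. -/
def SatisfiesIC (φ : Euc N → Euc N → ℝ) (U : Set (Euc N)) (μ ν : Measure (Euc N)) (C : ℝ≥0) :
    Prop :=
  ∀ A : Set (Euc N), NullMeasurableSet A volume → CompactlyContained A U →
    μ (measureClosure A) ≤ C * anisoPerimeter φ A + ν (measureInterior A)

open Classical in
/-- The extension `w̄ = w 𝟙_Ω + u₀ 𝟙_{ℝ^N ∖ closure Ω}`. -/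
def extend (Ω : Set (Euc N)) (u₀ w : Euc N → ℝ) : Euc N → ℝ := fun x =>
  if x ∈ Ω then w x else if x ∈ closure Ω then 0 else u₀ x

/-- The functional `Φ̂[w] = |Dw̄|_φ(closure Ω) + ∫_Ω w⁻ dμ₊ - ∫_Ω w⁺ dμ₋` for `w ∈ BV(Ω)`.
For a bounded Lipschitz domain, `u₀ ∈ W^{1,1}(ℝ^N)`, admissible `φ`, `μ₊`, `μ₋`, and `w ∈ BV(Ω)`,
the total variation is finite (as `w̄ ∈ BV(ℝ^N)`), `w⁺` and `w⁻` are finite a.e. with respect to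
`μ₊` and `μ₋`, and both integrals converge absolutely. -/
def functional (φ : Euc N → Euc N → ℝ) (Ω : Set (Euc N)) (u₀ : Euc N → ℝ)
    (μp μm : Measure (Euc N)) (w : Euc N → ℝ) : ℝ :=
  (anisoTV φ (extend Ω u₀ w) (closure Ω)).toReal
    + ∫ x in Ω, (approxLower Ω w x).toReal ∂μp - ∫ x in Ω, (approxUpper Ω w x).toReal ∂μm

end AnisoBV

end

/-!
The idea is to test the lower bound of the functional with `w = v + σ k 𝟙_A` for a sign `σ = ±1` and
`k → ∞`, where `v` is obtained from `u₀` by cutting it off near the compact set `closure A ⊆ Ω`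
(`MemW11.exists_cutoff`). Since `v` agrees with `u₀` outside `Ω` and the Lipschitz boundary of `Ω` is
Lebesgue-negligible (`volume_frontier_eq_zero`), the extension of `w` is almost everywhere equal to
`v + σ k 𝟙_A` on all of `ℝ^N`. Keeping `u₀` up to the boundary in this way creates no jump across
`∂Ω`, so that no trace theory is needed.

The gradient of `𝟙_A` lives on `closure A`, where the gradient of `v` vanishes. Hence the two
gradients are mutually singular, and, without any convexity of `φ`, the anisotropic variation of `w`
is at most `k` times that of `σ 𝟙_A` plus a constant independent of `k` (`anisoTV_le`). As `v`
vanishes near `closure A`, the approximate limits of `w` are those of `v` plus `σ k` times the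
indicators of `A⁺` or `A¹`; which of the two occurs depends on the sign, because `A¹` is the
complement of `(Aᶜ)⁺`. Dividing by `k` and letting `k → ∞` gives the isoperimetric inequality for
`φ` if `σ = 1` and for the mirrored integrand if `σ = -1` (`isoperimetric_of_bddBelow`).

The `k`-independent terms must be finite, that is, `v⁺` and `v⁻` must be integrable with respect to
the two measures (`IsAdmissibleMeasure.integrable_approx`). The hypothesis on the measures covers
non-negative functions only, so it is applied to `√(1 + v²) ≥ |v|`, which belongs to `BV(Ω)` by the
chain rule `HasWeakGradient.comp_contDiff`, proved by mollification. Measurability of `v⁺` and `v⁻`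
follows from that of `A⁺` (`measurableSet_measureClosure`).
-/

namespace AnisoBV

variable {N : ℕ}

/-! ### Sets of density one and of positive upper density -/

lemma volumeFraction_le_one (A : Set (Euc N)) (x : Euc N) (r : ℝ) : volumeFraction A x r ≤ 1 :=
  (ENNReal.div_le_div_right (measure_mono Set.inter_subset_left) _).trans ENNReal.div_self_le_one

lemma volumeFraction_mono {A B : Set (Euc N)} (h : A ⊆ B) (x : Euc N) (r : ℝ) :
    volumeFraction A x r ≤ volumeFraction B x r :=
  ENNReal.div_le_div_right (measure_mono (Set.inter_subset_inter_right _ h)) _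

lemma volumeFraction_add_compl {A : Set (Euc N)} (hA : NullMeasurableSet A volume) (x : Euc N)
    {r : ℝ} (hr : 0 < r) : volumeFraction A x r + volumeFraction Aᶜ x r = 1 := by
  unfold volumeFraction
  rw [← ENNReal.add_div, ← Set.sdiff_eq, measure_inter_add_sdiff₀ _ hA]
  exact ENNReal.div_self (Metric.measure_ball_pos volume x hr).ne' measure_ball_lt_top.ne

lemma volumeFraction_congr {A B : Set (Euc N)} {x : Euc N} (h : ∀ᶠ y in 𝓝 x, (y ∈ A ↔ y ∈ B)) :
    volumeFraction A x =ᶠ[𝓝[>] 0] volumeFraction B x := by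
  obtain ⟨ε, hε, hb⟩ := Metric.eventually_nhds_iff_ball.1 h
  filter_upwards [Ioo_mem_nhdsGT hε] with r hr
  have : Metric.ball x r ∩ A = Metric.ball x r ∩ B := by
    ext y
    simp only [Set.mem_inter_iff, and_congr_right_iff]
    exact fun hy => hb y (Metric.ball_subset_ball hr.2.le hy)
  simp only [volumeFraction, this]

lemma mem_measureClosure_congr {A B : Set (Euc N)} {x : Euc N}
    (h : ∀ᶠ y in 𝓝 x, (y ∈ A ↔ y ∈ B)) : x ∈ measureClosure A ↔ x ∈ measureClosure B := by
  simp only [measureClosure, Set.mem_ofPred_eq, limsup_congr (volumeFraction_congr h)]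

lemma mem_measureInterior_congr {A B : Set (Euc N)} {x : Euc N}
    (h : ∀ᶠ y in 𝓝 x, (y ∈ A ↔ y ∈ B)) : x ∈ measureInterior A ↔ x ∈ measureInterior B :=
  tendsto_congr' (volumeFraction_congr h)

lemma measureClosure_mono {A B : Set (Euc N)} (h : A ⊆ B) : measureClosure A ⊆ measureClosure B :=
  fun x hx => lt_of_lt_of_le (α := ℝ≥0∞) hx
    (limsup_le_limsup (Eventually.of_forall fun r => volumeFraction_mono h x r))

lemma measureInterior_mono {A B : Set (Euc N)} (h : A ⊆ B) :
    measureInterior A ⊆ measureInterior B :=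
  fun x hx => tendsto_of_tendsto_of_tendsto_of_le_of_le hx tendsto_const_nhds
    (fun r => volumeFraction_mono h x r) fun r => volumeFraction_le_one B x r

lemma notMem_measureClosure_empty (x : Euc N) : x ∉ measureClosure (∅ : Set (Euc N)) := by
  have h : volumeFraction (∅ : Set (Euc N)) x = fun _ => 0 := by
    ext r
    simp [volumeFraction]
  simp [measureClosure, h]

/-- Density one is complementary to positive upper density of the complement. -/
lemma measureInterior_eq_compl {A : Set (Euc N)} (hA : NullMeasurableSet A volume) :
    measureInterior A = (measureClosure Aᶜ)ᶜ := by
  ext x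
  have hev : ∀ᶠ r in 𝓝[>] (0 : ℝ), volumeFraction A x r + volumeFraction Aᶜ x r = 1 := by
    filter_upwards [self_mem_nhdsWithin] with r hr using volumeFraction_add_compl hA x hr
  simp only [measureInterior, measureClosure, Set.mem_ofPred_eq, Set.mem_compl_iff, not_lt]
  constructor
  · intro h
    have h0 : Tendsto (volumeFraction Aᶜ x) (𝓝[>] 0) (𝓝 (1 - 1)) := by
      refine (ENNReal.Tendsto.sub tendsto_const_nhds h (Or.inl ENNReal.one_ne_top)).congr' ?_
      filter_upwards [hev] with r hr
      rw [← hr]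
      exact ENNReal.add_sub_cancel_left
        ((volumeFraction_le_one A x r).trans_lt ENNReal.one_lt_top).ne
    simpa using h0.limsup_eq.le
  · intro h
    have h0 : Tendsto (volumeFraction Aᶜ x) (𝓝[>] 0) (𝓝 0) :=
      tendsto_of_le_liminf_of_limsup_le bot_le h
    have h1 : Tendsto (fun r => 1 - volumeFraction Aᶜ x r) (𝓝[>] 0) (𝓝 (1 - 0)) :=
      ENNReal.Tendsto.sub tendsto_const_nhds h0 (Or.inl ENNReal.one_ne_top)
    rw [tsub_zero] at h1
    refine h1.congr' ?_
    filter_upwards [hev] with r hr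
    rw [← hr]
    exact ENNReal.add_sub_cancel_right
      ((volumeFraction_le_one Aᶜ x r).trans_lt ENNReal.one_lt_top).ne

lemma measureInterior_compl_eq {A : Set (Euc N)} (hA : NullMeasurableSet A volume) :
    measureInterior Aᶜ = (measureClosure A)ᶜ := by
  rw [measureInterior_eq_compl hA.compl, compl_compl]

lemma measureClosure_compl_eq {A : Set (Euc N)} (hA : NullMeasurableSet A volume) :
    measureClosure Aᶜ = (measureInterior A)ᶜ := by
  rw [measureInterior_eq_compl hA, compl_compl]

lemma measureInterior_subset_measureClosure (A : Set (Euc N)) :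
    measureInterior A ⊆ measureClosure A := fun x hx => by
  have : limsup (volumeFraction A x) (𝓝[>] 0) = 1 := Tendsto.limsup_eq hx
  simp [measureClosure, this]

lemma mem_measureInterior_of_mem_nhds {A : Set (Euc N)} {x : Euc N} (h : A ∈ 𝓝 x) :
    x ∈ measureInterior A := by
  rw [mem_measureInterior_congr (B := Set.univ) (by filter_upwards [h] with y hy; simp [hy]),
    measureInterior_eq_compl MeasurableSet.univ.nullMeasurableSet, Set.compl_univ]
  exact notMem_measureClosure_empty x

lemma measureClosure_subset_closure (A : Set (Euc N)) : measureClosure A ⊆ closure A := by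
  intro x hx
  by_contra hxA
  have hev : ∀ᶠ y in 𝓝 x, (y ∈ A ↔ y ∈ (∅ : Set (Euc N))) := by
    filter_upwards [isClosed_closure.isOpen_compl.mem_nhds hxA] with y hy
    simpa using fun h => hy (subset_closure h)
  exact notMem_measureClosure_empty x ((mem_measureClosure_congr hev).1 hx)

/-- Inner approximation of an open ball by smaller balls makes `x ↦ |B_r(x) ∩ A|` lower
semicontinuous, for an arbitrary set `A`. -/
lemma isOpen_setOf_lt_volume_ball_inter (A : Set (Euc N)) (r : ℝ) (c : ℝ≥0∞) :
    IsOpen {x | c < volume (Metric.ball x r ∩ A)} := by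
  rw [isOpen_iff_mem_nhds]
  intro x hx
  have hmono : Monotone fun n : ℕ => Metric.ball x (r - 1 / ((n : ℝ) + 1)) ∩ A := by
    intro m n hmn
    refine Set.inter_subset_inter_left _ (Metric.ball_subset_ball ?_)
    have := one_div_le_one_div_of_le (by positivity : (0 : ℝ) < m + 1)
      (by gcongr : (m : ℝ) + 1 ≤ n + 1)
    linarith
  have hU : ⋃ n : ℕ, (Metric.ball x (r - 1 / ((n : ℝ) + 1)) ∩ A) = Metric.ball x r ∩ A := by
    rw [← Set.iUnion_inter]
    congr 1
    ext y
    simp only [Set.mem_iUnion, Metric.mem_ball]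
    constructor
    · rintro ⟨n, hn⟩
      have : (0 : ℝ) < 1 / ((n : ℝ) + 1) := by positivity
      linarith
    · intro hy
      obtain ⟨n, hn⟩ := exists_nat_one_div_lt (sub_pos.2 hy)
      exact ⟨n, by linarith⟩
  have hx' : c < ⨆ n : ℕ, volume (Metric.ball x (r - 1 / ((n : ℝ) + 1)) ∩ A) := by
    rw [← hmono.measure_iUnion, hU]
    exact hx
  obtain ⟨n, hn⟩ := lt_iSup_iff.1 hx'
  filter_upwards [Metric.ball_mem_nhds x (by positivity : (0 : ℝ) < 1 / ((n : ℝ) + 1))] with y hy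
  refine hn.trans_le (measure_mono (Set.inter_subset_inter_left _ ?_))
  refine Metric.ball_subset_ball' ?_
  rw [dist_comm]
  have := Metric.mem_ball.1 hy
  linarith

lemma measurableSet_measureClosure (A : Set (Euc N)) : MeasurableSet (measureClosure A) := by
  have hO (r : ℝ) (c : ℝ≥0∞) : IsOpen {x | c < volumeFraction A x r} := by
    by_cases hr : 0 < r
    · have hb (x : Euc N) : volume (Metric.ball x r) = volume (Metric.ball (0 : Euc N) r) :=
        Measure.addHaar_ball_center volume x r
      have h0 := (Metric.measure_ball_pos volume (0 : Euc N) hr).ne'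
      have h1 := (measure_ball_lt_top (μ := volume) (x := (0 : Euc N)) (r := r)).ne
      convert isOpen_setOf_lt_volume_ball_inter A r (c * volume (Metric.ball (0 : Euc N) r)) using 3
      rw [volumeFraction, hb, ENNReal.lt_div_iff_mul_lt (Or.inl h0) (Or.inl h1)]
    · simp [volumeFraction, Metric.ball_eq_empty.2 (not_lt.1 hr)]
  have heq : measureClosure A = ⋃ n : ℕ, ⋂ m : ℕ, ⋃ r ∈ Set.Ioo (0 : ℝ) (1 / ((m : ℝ) + 1)),
      {x | ((n : ℝ≥0∞) + 1)⁻¹ < volumeFraction A x r} := by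
    ext x
    simp only [measureClosure, Set.mem_ofPred_eq, Set.mem_iUnion, Set.mem_iInter, exists_prop]
    constructor
    · intro h
      obtain ⟨n, hn⟩ := ENNReal.exists_inv_nat_lt h.ne'
      have hfreq := frequently_lt_of_lt_limsup (by isBoundedDefault)
        ((ENNReal.inv_le_inv.2 (le_self_add : (n : ℝ≥0∞) ≤ n + 1)).trans_lt hn)
      refine ⟨n, fun m => ?_⟩
      obtain ⟨r, hr, hlt⟩ := (hfreq.and_eventually (Ioo_mem_nhdsGT
        (by positivity : (0 : ℝ) < 1 / ((m : ℝ) + 1)))).exists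
      exact ⟨r, hlt, hr⟩
    · rintro ⟨n, hn⟩
      have hpos : (0 : ℝ≥0∞) < ((n : ℝ≥0∞) + 1)⁻¹ := by
        simp [ENNReal.inv_pos, ENNReal.add_eq_top]
      refine hpos.trans_le (le_limsup_of_frequently_le ?_ (by isBoundedDefault))
      rw [frequently_iff]
      intro U hU
      obtain ⟨ε, hε, hsub⟩ := mem_nhdsGT_iff_exists_Ioo_subset.1 hU
      obtain ⟨m, hm⟩ := exists_nat_one_div_lt (Set.mem_Ioi.1 hε)
      obtain ⟨r, hr, hlt⟩ := hn m
      exact ⟨r, hsub ⟨hr.1, hr.2.trans hm⟩, hlt.le⟩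
  rw [heq]
  exact MeasurableSet.iUnion fun n => MeasurableSet.iInter fun m =>
    (isOpen_biUnion fun r _ => hO r _).measurableSet

lemma measurableSet_measureInterior {A : Set (Euc N)} (hA : NullMeasurableSet A volume) :
    MeasurableSet (measureInterior A) := by
  rw [measureInterior_eq_compl hA]
  exact (measurableSet_measureClosure _).compl

/-! ### Approximate upper and lower limits -/

/-- Approximate limits are suprema of down-sets of reals, determined up to the endpoint. -/
lemma sSup_coe_image_eq {S : Set ℝ} {c : ℝ} (h1 : ∀ t < c, t ∈ S) (h2 : ∀ t, c < t → t ∉ S) :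
    sSup ((fun t : ℝ => (t : EReal)) '' S) = c := by
  refine le_antisymm (sSup_le ?_) (le_of_forall_lt fun a ha => ?_)
  · rintro _ ⟨t, ht, rfl⟩
    exact EReal.coe_le_coe_iff.2 (not_lt.1 fun h => h2 t h ht)
  · obtain ⟨t, hat, htc⟩ := EReal.lt_iff_exists_real_btwn.1 ha
    exact hat.trans_le (le_sSup ⟨t, h1 t (EReal.coe_lt_coe_iff.1 htc), rfl⟩)

lemma approxUpper_congr {U : Set (Euc N)} {u u' : Euc N → ℝ} {x : Euc N} (h : u =ᶠ[𝓝 x] u') :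
    approxUpper U u x = approxUpper U u' x := by
  unfold approxUpper
  congr 2
  ext t
  refine mem_measureClosure_congr ?_
  filter_upwards [h] with y hy
  exact and_congr_right fun _ => by rw [hy]

lemma approxLower_congr {U : Set (Euc N)} {u u' : Euc N → ℝ} {x : Euc N} (h : u =ᶠ[𝓝 x] u') :
    approxLower U u x = approxLower U u' x := by
  unfold approxLower
  congr 2
  ext t
  refine mem_measureInterior_congr ?_
  filter_upwards [h] with y hy
  exact and_congr_right fun _ => by rw [hy]

lemma approxUpper_mono {U : Set (Euc N)} {u u' : Euc N → ℝ} (h : ∀ y ∈ U, u y ≤ u' y)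
    (x : Euc N) : approxUpper U u x ≤ approxUpper U u' x :=
  sSup_le_sSup (Set.image_mono fun _ ht =>
    measureClosure_mono (fun _ hy => And.intro hy.1 (hy.2.trans_le (h _ hy.1))) ht)

lemma approxLower_le_approxUpper (U : Set (Euc N)) (u : Euc N → ℝ) (x : Euc N) :
    approxLower U u x ≤ approxUpper U u x :=
  sSup_le_sSup (Set.image_mono fun _ ht => measureInterior_subset_measureClosure _ ht)

section Indicator

variable {U A : Set (Euc N)} {x : Euc N} {c : ℝ}

lemma eventually_mem_superlevel (hU : IsOpen U) (hx : x ∈ U) (t : ℝ) :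
    ∀ᶠ y in 𝓝 x, (y ∈ {y | y ∈ U ∧ t < A.indicator (fun _ => c) y} ↔
      y ∈ {y | t < A.indicator (fun _ => c) y}) := by
  filter_upwards [hU.mem_nhds hx] with y hy
  simp [hy]

lemma superlevel_indicator (t : ℝ) : {y | t < A.indicator (fun _ => c) y} =
    (if t < c then A else ∅) ∪ (if t < 0 then Aᶜ else ∅) := by
  ext y
  by_cases hy : y ∈ A <;> by_cases h1 : t < c <;> by_cases h2 : t < 0 <;> simp [hy, h1, h2]

lemma approxUpper_indicator_pos [DecidablePred (· ∈ measureClosure A)] (hU : IsOpen U)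
    (hx : x ∈ U) (hc : 0 < c) : approxUpper U (A.indicator fun _ => c) x =
      ((if x ∈ measureClosure A then c else 0 : ℝ) : EReal) := by
  refine sSup_coe_image_eq ?_ ?_ <;> intro t ht <;>
    simp only [Set.mem_ofPred_eq, mem_measureClosure_congr (eventually_mem_superlevel hU hx t),
      superlevel_indicator]
  · by_cases h0 : t < 0
    · simp only [h0, h0.trans hc, if_true, Set.union_compl_self]
      exact measureInterior_subset_measureClosure _ (mem_measureInterior_of_mem_nhds univ_mem)
    · split_ifs at ht with hxA
      · simpa [h0, ht] using hxA
      · exact absurd ht h0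
  · split_ifs at ht with hxA
    · simpa [ht.le, (hc.trans ht).le, not_lt.2] using notMem_measureClosure_empty x
    · by_cases h1 : t < c
      · simpa [h1, ht.le, not_lt.2] using hxA
      · simpa [h1, ht.le, not_lt.2] using notMem_measureClosure_empty x

lemma approxLower_indicator_pos [DecidablePred (· ∈ measureInterior A)] (hU : IsOpen U)
    (hx : x ∈ U) (hc : 0 < c) : approxLower U (A.indicator fun _ => c) x =
      ((if x ∈ measureInterior A then c else 0 : ℝ) : EReal) := by
  have hempty : x ∉ measureInterior (∅ : Set (Euc N)) := fun h =>
    notMem_measureClosure_empty x (measureInterior_subset_measureClosure _ h)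
  refine sSup_coe_image_eq ?_ ?_ <;> intro t ht <;>
    simp only [Set.mem_ofPred_eq, mem_measureInterior_congr (eventually_mem_superlevel hU hx t),
      superlevel_indicator]
  · by_cases h0 : t < 0
    · simp only [h0, h0.trans hc, if_true, Set.union_compl_self]
      exact mem_measureInterior_of_mem_nhds univ_mem
    · split_ifs at ht with hxA
      · simpa [h0, ht] using hxA
      · exact absurd ht h0
  · split_ifs at ht with hxA
    · simpa [ht.le, (hc.trans ht).le, not_lt.2] using hempty
    · by_cases h1 : t < c
      · simpa [h1, ht.le, not_lt.2] using hxA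
      · simpa [h1, ht.le, not_lt.2] using hempty

lemma approxUpper_indicator_neg [DecidablePred (· ∈ measureInterior A)]
    (hA : NullMeasurableSet A volume) (hU : IsOpen U)
    (hx : x ∈ U) (hc : c < 0) : approxUpper U (A.indicator fun _ => c) x =
      ((if x ∈ measureInterior A then c else 0 : ℝ) : EReal) := by
  refine sSup_coe_image_eq ?_ ?_ <;> intro t ht <;>
    simp only [Set.mem_ofPred_eq, mem_measureClosure_congr (eventually_mem_superlevel hU hx t),
      superlevel_indicator]
  · by_cases h0 : t < c
    · simp only [h0, h0.trans hc, if_true, Set.union_compl_self]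
      exact measureInterior_subset_measureClosure _ (mem_measureInterior_of_mem_nhds univ_mem)
    · split_ifs at ht with hxA
      · exact absurd ht h0
      · simpa [h0, ht, measureClosure_compl_eq hA] using hxA
  · split_ifs at ht with hxA
    · by_cases h1 : t < 0
      · simpa [h1, ht.le, not_lt.2, measureClosure_compl_eq hA] using hxA
      · simpa [h1, ht.le, not_lt.2] using notMem_measureClosure_empty x
    · simpa [ht.le, (hc.trans ht).le, not_lt.2] using notMem_measureClosure_empty x

lemma approxLower_indicator_neg [DecidablePred (· ∈ measureClosure A)]
    (hA : NullMeasurableSet A volume) (hU : IsOpen U)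
    (hx : x ∈ U) (hc : c < 0) : approxLower U (A.indicator fun _ => c) x =
      ((if x ∈ measureClosure A then c else 0 : ℝ) : EReal) := by
  have hempty : x ∉ measureInterior (∅ : Set (Euc N)) := fun h =>
    notMem_measureClosure_empty x (measureInterior_subset_measureClosure _ h)
  refine sSup_coe_image_eq ?_ ?_ <;> intro t ht <;>
    simp only [Set.mem_ofPred_eq, mem_measureInterior_congr (eventually_mem_superlevel hU hx t),
      superlevel_indicator]
  · by_cases h0 : t < c
    · simp only [h0, h0.trans hc, if_true, Set.union_compl_self]
      exact mem_measureInterior_of_mem_nhds univ_mem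
    · split_ifs at ht with hxA
      · exact absurd ht h0
      · simpa [h0, ht, measureInterior_compl_eq hA] using hxA
  · split_ifs at ht with hxA
    · by_cases h1 : t < 0
      · simpa [h1, ht.le, not_lt.2, measureInterior_compl_eq hA] using hxA
      · simpa [h1, ht.le, not_lt.2] using hempty
    · simpa [ht.le, (hc.trans ht).le, not_lt.2] using hempty

end Indicator

/-- A function `V ≥ |u|` bounds the approximate lower limit of `u` from below. -/
lemma neg_approxUpper_le_approxLower {U : Set (Euc N)} (hU : IsOpen U) {u V : Euc N → ℝ}
    (hV : ∀ t, NullMeasurableSet {y | y ∈ U ∧ t < V y} volume)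
    (h : ∀ y, |u y| ≤ V y) {x : Euc N} (hx : x ∈ U) :
    -approxUpper U V x ≤ approxLower U u x := by
  by_contra! hlt
  obtain ⟨r, hr1, hr2⟩ := EReal.lt_iff_exists_real_btwn.1 hlt
  have hr3 : approxUpper U V x < ((-r : ℝ) : EReal) := by
    rw [EReal.coe_neg]
    exact EReal.lt_neg_comm.1 hr2
  have hmem : x ∈ measureInterior {y | y ∈ U ∧ -r < V y}ᶜ := by
    rw [measureInterior_compl_eq (hV _)]
    exact fun hc => hr3.not_ge (le_sSup ⟨-r, hc, rfl⟩)
  refine hr1.not_ge (le_of_forall_lt fun a ha => ?_)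
  obtain ⟨t, hat, htr⟩ := EReal.lt_iff_exists_real_btwn.1 ha
  refine hat.trans_le (le_sSup ⟨t, ?_, rfl⟩)
  rw [Set.mem_ofPred_eq, mem_measureInterior_congr
    (B := {y | y ∈ U ∧ t < u y} ∪ Uᶜ) (by filter_upwards [hU.mem_nhds hx] with y hy; simp [hy])]
  refine measureInterior_mono (fun y hy => ?_) hmem
  by_cases hyU : y ∈ U
  · have h1 : V y ≤ -r := not_lt.1 fun hc => hy ⟨hyU, hc⟩
    have h2 := neg_le_of_abs_le (h y)
    have h3 := EReal.coe_lt_coe_iff.1 htr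
    exact Or.inl ⟨hyU, by linarith⟩
  · exact Or.inr hyU

lemma measurable_sSup_coe_image {S : Euc N → Set ℝ} (hS : ∀ x, ∀ t ∈ S x, ∀ s ≤ t, s ∈ S x)
    (hm : ∀ t, MeasurableSet {x | t ∈ S x}) :
    Measurable fun x => sSup ((fun t : ℝ => (t : EReal)) '' S x) := by
  refine measurable_of_Ioi fun a => ?_
  have : (fun x => sSup ((fun t : ℝ => (t : EReal)) '' S x)) ⁻¹' Set.Ioi a =
      ⋃ q : ℚ, ⋃ _ : a < ((q : ℝ) : EReal), {x | (q : ℝ) ∈ S x} := by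
    ext x
    simp only [Set.mem_preimage, Set.mem_Ioi, Set.mem_iUnion, lt_sSup_iff]
    constructor
    · rintro ⟨_, ⟨t, ht, rfl⟩, hat⟩
      obtain ⟨q, hq1, hq2⟩ := EReal.lt_iff_exists_rat_btwn.1 hat
      exact ⟨q, hq1, hS x t ht _ (EReal.coe_lt_coe_iff.1 hq2).le⟩
    · rintro ⟨q, hq, hmem⟩
      exact ⟨_, ⟨_, hmem, rfl⟩, hq⟩
  rw [this]
  exact MeasurableSet.iUnion fun q => MeasurableSet.iUnion fun _ => hm q

lemma measurable_approxUpper (U : Set (Euc N)) (u : Euc N → ℝ) : Measurable (approxUpper U u) :=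
  measurable_sSup_coe_image
    (fun _ _ ht _ hs => measureClosure_mono (fun _ hy => And.imp_right hs.trans_lt hy) ht)
    fun _ => measurableSet_measureClosure _

lemma nullMeasurableSet_superlevel {U : Set (Euc N)} {u : Euc N → ℝ} (hU : IsOpen U)
    (hu : AEMeasurable u volume) (t : ℝ) : NullMeasurableSet {y | y ∈ U ∧ t < u y} volume :=
  hU.measurableSet.nullMeasurableSet.inter (nullMeasurableSet_lt aemeasurable_const hu)

lemma measurable_approxLower {U : Set (Euc N)} {u : Euc N → ℝ} (hU : IsOpen U)
    (hu : AEMeasurable u volume) : Measurable (approxLower U u) :=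
  measurable_sSup_coe_image
    (fun _ _ ht _ hs => measureInterior_mono (fun _ hy => And.imp_right hs.trans_lt hy) ht)
    fun t => measurableSet_measureInterior (nullMeasurableSet_superlevel hU hu t)

/-! ### Weak gradients: product rule, chain rule -/

/-- The function `G` is the weak gradient of `u` on `ℝ^N`, that is, `Du = G dx`. Integrability of
`u` and `G` is not part of the definition. -/
def HasWeakGradient (u : Euc N → ℝ) (G : Euc N → Euc N) : Prop :=
  ∀ η : Euc N → ℝ, ContDiff ℝ (⊤ : ℕ∞) η → HasCompactSupport η → ∀ v : Euc N,
    ∫ x, u x * fderiv ℝ η x v = -∫ x, η x * ⟪G x, v⟫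

lemma continuous_fderiv_apply_const {η : Euc N → ℝ} (hη : ContDiff ℝ (⊤ : ℕ∞) η) (v : Euc N) :
    Continuous fun x => fderiv ℝ η x v :=
  (hη.continuous_fderiv (by simp)).clm_apply continuous_const

lemma hasCompactSupport_fderiv_apply_const {η : Euc N → ℝ} (hc : HasCompactSupport η)
    (v : Euc N) : HasCompactSupport fun x => fderiv ℝ η x v :=
  (hc.fderiv ℝ).comp_left (g := fun L : Euc N →L[ℝ] ℝ => L v) (by simp)

lemma integrable_mul_of_hasCompactSupport {f g : Euc N → ℝ} (hf : LocallyIntegrable f volume)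
    (hg : Continuous g) (hc : HasCompactSupport g) : Integrable (fun x => f x * g x) volume := by
  simpa [mul_comm] using hf.integrable_smul_left_of_hasCompactSupport hg hc

/-- Product rule for a weakly differentiable function and a smooth function. -/
lemma HasWeakGradient.mul_contDiff {u : Euc N → ℝ} {G : Euc N → Euc N} (h : HasWeakGradient u G)
    (hu : LocallyIntegrable u volume) (hG : LocallyIntegrable G volume) {ψ : Euc N → ℝ}
    (hψ : ContDiff ℝ (⊤ : ℕ∞) ψ) :
    HasWeakGradient (fun x => ψ x * u x) fun x => ψ x • G x + u x • gradient ψ x := by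
  intro η hη hc v
  have hprod (x : Euc N) : fderiv ℝ (fun y => ψ y * η y) x v
      = ψ x * fderiv ℝ η x v + fderiv ℝ ψ x v * η x := by
    have hd1 : DifferentiableAt ℝ ψ x := hψ.differentiable (by simp) x
    have hd2 : DifferentiableAt ℝ η x := hη.differentiable (by simp) x
    rw [fderiv_fun_mul hd1 hd2]
    simp [mul_comm]
  have h1 := h (fun y => ψ y * η y) (hψ.mul hη) (hc.mul_left) v
  have hGv : LocallyIntegrable (fun x => ⟪G x, v⟫) volume := by
    intro x
    obtain ⟨s, hs, hi⟩ := hG x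
    exact ⟨s, hs, hi.inner_const v⟩
  have i1 : Integrable (fun x => u x * (ψ x * fderiv ℝ η x v)) volume :=
    integrable_mul_of_hasCompactSupport hu
      (hψ.continuous.mul (continuous_fderiv_apply_const hη v))
      (hasCompactSupport_fderiv_apply_const hc v).mul_left
  have i2 : Integrable (fun x => u x * (fderiv ℝ ψ x v * η x)) volume :=
    integrable_mul_of_hasCompactSupport hu
      ((continuous_fderiv_apply_const hψ v).mul hη.continuous) hc.mul_left
  have i3 : Integrable (fun x => ⟪G x, v⟫ * (ψ x * η x)) volume :=
    integrable_mul_of_hasCompactSupport hGv (hψ.continuous.mul hη.continuous) hc.mul_left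
  have e1 : ∫ x, u x * fderiv ℝ (fun y => ψ y * η y) x v
      = (∫ x, u x * (ψ x * fderiv ℝ η x v)) + ∫ x, u x * (fderiv ℝ ψ x v * η x) := by
    rw [← integral_add i1 i2]
    congr with x
    rw [hprod]; ring
  have e2 : ∫ x, η x * ⟪ψ x • G x + u x • gradient ψ x, v⟫
      = (∫ x, ⟪G x, v⟫ * (ψ x * η x)) + ∫ x, u x * (fderiv ℝ ψ x v * η x) := by
    rw [← integral_add i3 i2]
    congr with x
    rw [inner_add_left, real_inner_smul_left, real_inner_smul_left, inner_gradient_left]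
    ring
  have e3 : ∫ x, ψ x * η x * ⟪G x, v⟫ = ∫ x, ⟪G x, v⟫ * (ψ x * η x) := by
    congr with x; ring
  have e4 : ∫ x, ψ x * u x * fderiv ℝ η x v = ∫ x, u x * (ψ x * fderiv ℝ η x v) := by
    congr with x; ring
  rw [e4, e2]
  rw [e1, e3] at h1
  linarith

/-- Normed bump functions supported in balls shrinking to the origin. -/
noncomputable def mollifier (N : ℕ) (n : ℕ) : ContDiffBump (0 : Euc N) where
  rIn := 1 / ((n : ℝ) + 1)
  rOut := 2 / ((n : ℝ) + 1)
  rIn_pos := by positivity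
  rIn_lt_rOut := by gcongr; norm_num

/-- The regularization of `f` by the `n`-th mollifier. -/
noncomputable def mollify (n : ℕ) (f : Euc N → ℝ) : Euc N → ℝ :=
  convolution ((mollifier N n).normed volume) f (ContinuousLinearMap.lsmul ℝ ℝ) volume

lemma ae_tendsto_mollify {f : Euc N → ℝ} (hf : LocallyIntegrable f volume) :
    ∀ᵐ x, Tendsto (fun n => mollify n f x) atTop (𝓝 (f x)) := by
  refine ContDiffBump.ae_convolution_tendsto_right_of_locallyIntegrable (K := 2) ?_ ?_ hf
  · have := (tendsto_one_div_add_atTop_nhds_zero_nat (𝕜 := ℝ)).const_mul 2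
    simpa [mollifier, div_eq_mul_inv] using this
  · refine Eventually.of_forall fun n => le_of_eq ?_
    simp [mollifier, div_eq_mul_inv]

lemma contDiff_mollify (n : ℕ) {f : Euc N → ℝ} (hf : LocallyIntegrable f volume) :
    ContDiff ℝ (⊤ : ℕ∞) (mollify n f) :=
  (mollifier N n).hasCompactSupport_normed.contDiff_convolution_left _
    (mollifier N n).contDiff_normed hf

lemma integrable_mollify (n : ℕ) {f : Euc N → ℝ} (hf : Integrable f volume) :
    Integrable (mollify n f) volume :=
  Integrable.integrable_convolution _ (mollifier N n).integrable_normed hf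

lemma integral_abs_mollify_le (n : ℕ) {f : Euc N → ℝ} (hf : Integrable f volume) :
    ∫ x, |mollify n f x| ≤ ∫ x, |f x| := by
  have h1 : ∫ x, mollify n (fun y => |f y|) x = ∫ x, |f x| := by
    have := integral_convolution (ContinuousLinearMap.lsmul ℝ ℝ)
      ((mollifier N n).integrable_normed (μ := volume)) hf.abs
    rw [(mollifier N n).integral_normed] at this
    simpa [mollify] using this
  rw [← h1]
  refine integral_mono (integrable_mollify n hf).abs (integrable_mollify n hf.abs) fun x => ?_
  simp only [mollify, convolution, ContinuousLinearMap.lsmul_apply, smul_eq_mul]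
  refine (abs_integral_le_integral_abs).trans (le_of_eq ?_)
  congr with t
  rw [abs_mul, abs_of_nonneg ((mollifier N n).nonneg_normed t)]

/-- Mollifications converge in `L¹`: they converge almost everywhere without gaining mass. -/
lemma tendsto_integral_abs_mollify_sub {f : Euc N → ℝ} (hf : Integrable f volume) :
    Tendsto (fun n => ∫ x, |mollify n f x - f x|) atTop (𝓝 0) := by
  have hm (n : ℕ) := integrable_mollify n hf
  -- `|fₙ - f| - |fₙ|` is dominated by `|f|`, although `fₙ` itself need not be dominated.
  have hlim : Tendsto (fun n => ∫ x, (|mollify n f x - f x| - |mollify n f x|)) atTop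
      (𝓝 (∫ x, -|f x|)) := by
    refine tendsto_integral_of_dominated_convergence (fun x => |f x|)
      (fun n => ((hm n).sub hf).abs.aestronglyMeasurable.sub (hm n).abs.aestronglyMeasurable)
      hf.abs (fun n => Eventually.of_forall fun x => ?_) ?_
    · have := abs_abs_sub_abs_le (mollify n f x - f x) (mollify n f x)
      simpa using this
    · filter_upwards [ae_tendsto_mollify hf.locallyIntegrable] with x hx
      simpa using (hx.sub_const (f x)).abs.sub hx.abs
  have hlim2 := hlim.add_const (∫ x, |f x|)
  rw [integral_neg, neg_add_cancel] at hlim2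
  refine squeeze_zero (fun n => integral_nonneg fun x => abs_nonneg _) (fun n => ?_) hlim2
  have e := integral_sub ((hm n).sub hf).abs (hm n).abs
  simp only [Pi.sub_apply] at e
  rw [e]
  have := integral_abs_mollify_le n hf
  linarith

/-- Mollification commutes with weak differentiation. -/
lemma HasWeakGradient.fderiv_mollify {u : Euc N → ℝ} {G : Euc N → Euc N}
    (h : HasWeakGradient u G) (hu : LocallyIntegrable u volume) (n : ℕ) (x v : Euc N) :
    fderiv ℝ (mollify n u) x v = mollify n (fun y => ⟪G y, v⟫) x := by
  set f := (mollifier N n).normed volume with hf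
  have hfs : ContDiff ℝ (⊤ : ℕ∞) f := (mollifier N n).contDiff_normed
  have hfc : HasCompactSupport f := (mollifier N n).hasCompactSupport_normed
  have hd := hfc.hasFDerivAt_convolution_left (ContinuousLinearMap.lsmul ℝ ℝ)
    (hfs.of_le (by simp)) hu x
  have hη := h (fun y => f (x - y)) (hfs.comp (contDiff_const.sub contDiff_id))
    (hfc.comp_homeomorph (Homeomorph.subLeft x)) v
  have hfd (y : Euc N) : fderiv ℝ (fun y => f (x - y)) y v = -fderiv ℝ f (x - y) v := by
    have h1 : HasFDerivAt f (fderiv ℝ f (x - y)) (x - y) :=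
      (hfs.differentiable (by simp) _).hasFDerivAt
    have h2 := h1.comp y ((hasFDerivAt_id y).const_sub x)
    rw [show (fun y => f (x - y)) = f ∘ fun y => x - y from rfl, h2.fderiv]
    simp
  simp only [hfd, mul_neg, integral_neg, neg_inj] at hη
  have hex := (hfc.fderiv ℝ).convolutionExists_left
    ((ContinuousLinearMap.lsmul ℝ ℝ).precompL (Euc N) : (Euc N →L[ℝ] ℝ) →L[ℝ] ℝ →L[ℝ] Euc N →L[ℝ] ℝ)
    (hfs.continuous_fderiv (by simp)) hu x
  have hi := hex.integrable_swap
  unfold mollify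
  rw [hd.fderiv, convolution_eq_swap, convolution_eq_swap, ContinuousLinearMap.integral_apply hi]
  simp only [ContinuousLinearMap.precompL_apply, ContinuousLinearMap.lsmul_apply, smul_eq_mul]
  rw [← hf, ← hη]
  congr with y
  ring

/-- Chain rule for `h ∘ u` with `h` a smooth `1`-Lipschitz function, by regularization of `u`. -/
lemma HasWeakGradient.comp_contDiff {u : Euc N → ℝ} {G : Euc N → Euc N}
    (hw : HasWeakGradient u G) (hu : Integrable u volume) (hG : Integrable G volume) {h : ℝ → ℝ}
    (hh : ContDiff ℝ (⊤ : ℕ∞) h) (hh' : ∀ t, |deriv h t| ≤ 1) :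
    HasWeakGradient (fun x => h (u x)) fun x => deriv h (u x) • G x := by
  intro η hη hc v
  have hhd : Differentiable ℝ h := hh.differentiable (by simp)
  have hLip (s t : ℝ) : |h s - h t| ≤ |s - t| := by
    have := (convex_univ (𝕜 := ℝ) (E := ℝ)).norm_image_sub_le_of_norm_deriv_le (f := h) (C := 1)
      (fun x _ => hhd x) (fun x _ => hh' x) (Set.mem_univ t) (Set.mem_univ s)
    simpa using this
  have hdc : Continuous (deriv h) := hh.continuous_deriv (by simp)
  have hg : Integrable (fun x => ⟪G x, v⟫) volume := hG.inner_const v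
  set g : Euc N → ℝ := fun x => ⟪G x, v⟫ with hgdef
  have hum (n : ℕ) := contDiff_mollify n hu.locallyIntegrable
  have hη'c := continuous_fderiv_apply_const hη v
  have hη's := hasCompactSupport_fderiv_apply_const hc v
  obtain ⟨C, hC⟩ := hη.continuous.bounded_above_of_compact_support hc
  obtain ⟨C', hC'⟩ := hη'c.bounded_above_of_compact_support hη's
  have hC0 : 0 ≤ C := (norm_nonneg _).trans (hC 0)
  have hC0' : 0 ≤ C' := (norm_nonneg _).trans (hC' 0)
  have hparts (n : ℕ) : ∫ x, h (mollify n u x) * fderiv ℝ η x v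
      = -∫ x, η x * (deriv h (mollify n u x) * mollify n g x) := by
    have hcomp : ContDiff ℝ (⊤ : ℕ∞) fun x => h (mollify n u x) := hh.comp (hum n)
    have hfd (x : Euc N) : fderiv ℝ (fun x => h (mollify n u x)) x v
        = deriv h (mollify n u x) * mollify n g x := by
      have h1 : HasFDerivAt (mollify n u) (fderiv ℝ (mollify n u) x) x :=
        ((hum n).differentiable (by simp) x).hasFDerivAt
      have h2 := (hhd (mollify n u x)).hasDerivAt.comp_hasFDerivAt x h1
      have h3 : fderiv ℝ (fun x => h (mollify n u x)) x
          = deriv h (mollify n u x) • fderiv ℝ (mollify n u) x := h2.fderiv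
      rw [h3, _root_.smul_apply, hw.fderiv_mollify hu.locallyIntegrable, smul_eq_mul]
    have hci := hcomp.continuous.locallyIntegrable (μ := (volume : Measure (Euc N)))
    have hfi := (continuous_fderiv_apply_const hcomp v).locallyIntegrable
      (μ := (volume : Measure (Euc N)))
    rw [integral_mul_fderiv_eq_neg_fderiv_mul_of_integrable
      (integrable_mul_of_hasCompactSupport hfi hη.continuous hc)
      (integrable_mul_of_hasCompactSupport hci hη'c hη's)
      (integrable_mul_of_hasCompactSupport hci hη.continuous hc)
      (fun x _ => hcomp.differentiable (by simp) x) (fun x _ => hη.differentiable (by simp) x)]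
    congr 2 with x
    rw [hfd]; ring
  have hLI : LocallyIntegrable (fun x => h (u x)) volume := by
    have hb : LocallyIntegrable (fun x => |h 0| + |u x|) volume :=
      (locallyIntegrable_const _).add hu.abs.locallyIntegrable
    refine hb.mono (hh.continuous.comp_aestronglyMeasurable hu.aestronglyMeasurable)
      (Eventually.of_forall fun x => ?_)
    have h1 := hLip (u x) 0
    have h2 := abs_sub_abs_le_abs_sub (h (u x)) (h 0)
    rw [sub_zero] at h1
    rw [Real.norm_eq_abs, Real.norm_eq_abs, abs_of_nonneg (by positivity : 0 ≤ |h 0| + |u x|)]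
    linarith
  have hl1 : Tendsto (fun n => ∫ x, h (mollify n u x) * fderiv ℝ η x v) atTop
      (𝓝 (∫ x, h (u x) * fderiv ℝ η x v)) := by
    rw [tendsto_iff_norm_sub_tendsto_zero]
    have hb := (tendsto_integral_abs_mollify_sub hu).const_mul C'
    rw [mul_zero] at hb
    refine squeeze_zero (fun n => norm_nonneg _) (fun n => ?_) hb
    have hci := ((hh.comp (hum n)).continuous).locallyIntegrable (μ := (volume : Measure (Euc N)))
    have e := integral_sub (integrable_mul_of_hasCompactSupport hci hη'c hη's)
      (integrable_mul_of_hasCompactSupport hLI hη'c hη's)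
    simp only [Function.comp_apply] at e
    rw [← e, ← integral_const_mul]
    refine norm_integral_le_of_norm_le
      (((integrable_mollify n hu).sub hu).abs.const_mul C') (Eventually.of_forall fun x => ?_)
    rw [← sub_mul, norm_mul, mul_comm]
    exact mul_le_mul (hC' x) (hLip _ _) (norm_nonneg _) hC0'
  have hmd (n : ℕ) : AEStronglyMeasurable (fun x => η x * deriv h (mollify n u x)) volume :=
    (hη.continuous.mul (hdc.comp (hum n).continuous)).aestronglyMeasurable
  have hbd (s : ℝ) (x : Euc N) : ‖η x * deriv h s‖ ≤ C := by
    rw [norm_mul]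
    calc ‖η x‖ * ‖deriv h s‖ ≤ C * 1 := mul_le_mul (hC x) (hh' s) (norm_nonneg _) hC0
      _ = C := mul_one C
  have hl2 : Tendsto (fun n => ∫ x, η x * deriv h (mollify n u x) * g x) atTop
      (𝓝 (∫ x, η x * deriv h (u x) * g x)) := by
    refine tendsto_integral_of_dominated_convergence (fun x => C * |g x|)
      (fun n => (hmd n).mul hg.aestronglyMeasurable) (hg.abs.const_mul C)
      (fun n => Eventually.of_forall fun x => ?_) ?_
    · rw [norm_mul]
      exact mul_le_mul_of_nonneg_right (hbd _ x) (norm_nonneg _)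
    · filter_upwards [ae_tendsto_mollify hu.locallyIntegrable] with x hx
      exact (((hdc.tendsto _).comp hx).const_mul (η x)).mul_const (g x)
  have hl3 : Tendsto (fun n => ∫ x, η x * deriv h (mollify n u x) * (mollify n g x - g x)) atTop
      (𝓝 0) := by
    rw [tendsto_zero_iff_norm_tendsto_zero]
    have hb := (tendsto_integral_abs_mollify_sub hg).const_mul C
    rw [mul_zero] at hb
    refine squeeze_zero (fun n => norm_nonneg _) (fun n => ?_) hb
    rw [← integral_const_mul]
    refine norm_integral_le_of_norm_le
      (((integrable_mollify n hg).sub hg).abs.const_mul C) (Eventually.of_forall fun x => ?_)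
    rw [norm_mul]
    exact mul_le_mul_of_nonneg_right (hbd _ x) (norm_nonneg _)
  have hl4 : Tendsto (fun n => ∫ x, η x * (deriv h (mollify n u x) * mollify n g x)) atTop
      (𝓝 (∫ x, η x * deriv h (u x) * g x)) := by
    have := hl2.add hl3
    rw [add_zero] at this
    refine this.congr fun n => ?_
    have e := integral_add (hg.bdd_mul (hmd n) (Eventually.of_forall fun x => hbd _ x))
      (((integrable_mollify n hg).sub hg).bdd_mul (hmd n) (Eventually.of_forall fun x => hbd _ x))
    simp only [Pi.sub_apply] at e
    rw [← e]
    congr with x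
    ring
  have := tendsto_nhds_unique (hl1.congr hparts) hl4.neg
  rw [this]
  congr 2 with x
  rw [real_inner_smul_left]
  ring

/-! ### Gradient measures in polar form -/

lemma HasPolarGradient.isFiniteMeasureOnCompacts {u : Euc N → ℝ} {ρ : Measure (Euc N)}
    {ν : Euc N → Euc N} (h : HasPolarGradient Set.univ u ρ ν) : IsFiniteMeasureOnCompacts ρ :=
  ⟨fun K hK => h.lt_top_of_isCompact K hK (Set.subset_univ K)⟩

lemma integrable_mul_inner {ρ : Measure (Euc N)} [IsFiniteMeasureOnCompacts ρ]
    {ν : Euc N → Euc N} (hν : Measurable ν) (hν1 : ∀ᵐ x ∂ρ, ‖ν x‖ ≤ 1) {η : Euc N → ℝ}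
    (hη : Continuous η) (hc : HasCompactSupport η) (v : Euc N) :
    Integrable (fun x => η x * ⟪ν x, v⟫) ρ := by
  have hi : Integrable η ρ := hη.integrable_of_hasCompactSupport hc
  refine hi.mul_bdd (c := ‖v‖) (hν.inner_const).aestronglyMeasurable ?_
  filter_upwards [hν1] with x hx
  calc ‖⟪ν x, v⟫‖ ≤ ‖ν x‖ * ‖v‖ := norm_inner_le_norm _ _
    _ ≤ 1 * ‖v‖ := by gcongr
    _ = ‖v‖ := one_mul _

lemma hasPolarGradient_zero : HasPolarGradient Set.univ (0 : Euc N → ℝ) 0 0 where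
  compl_eq_zero := by simp
  lt_top_of_isCompact := by simp
  measurable := measurable_zero
  norm_eq_one := by simp
  integral_eq := by simp

/-- Restriction of a distributional gradient from `ℝ^N` to an open set. -/
lemma HasPolarGradient.restrict {u : Euc N → ℝ} {ρ : Measure (Euc N)} {ν : Euc N → Euc N}
    (h : HasPolarGradient Set.univ u ρ ν) {U : Set (Euc N)} (hU : MeasurableSet U) :
    HasPolarGradient U u (ρ.restrict U) ν where
  compl_eq_zero := by rw [Measure.restrict_apply hU.compl]; simp
  lt_top_of_isCompact K hK _ :=
    (Measure.restrict_apply_le U K).trans_lt (h.lt_top_of_isCompact K hK (Set.subset_univ K))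
  measurable := h.measurable
  norm_eq_one := ae_restrict_of_ae h.norm_eq_one
  integral_eq η hη hc hs v := by
    rw [setIntegral_eq_integral_of_forall_compl_eq_zero,
      setIntegral_eq_integral_of_forall_compl_eq_zero]
    · simpa using h.integral_eq η hη hc (Set.subset_univ _) v
    · intro x hx
      have hx' : x ∉ tsupport η := fun h => hx (hs h)
      rw [image_eq_zero_of_notMem_tsupport hx', zero_mul]
    · intro x hx
      have hx' : x ∉ tsupport η := fun h => hx (hs h)
      rw [image_eq_zero_of_notMem_tsupport fun h => hx' (tsupport_fderiv_subset ℝ h)]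
      simp

/-- The total variation measure of `1_A` does not charge the complement of the closure of `A`. -/
lemma HasPolarGradient.measure_compl_closure {A : Set (Euc N)} {ρ : Measure (Euc N)}
    {ν : Euc N → Euc N} (h : HasPolarGradient Set.univ (A.indicator fun _ => (1 : ℝ)) ρ ν) :
    ρ (closure A)ᶜ = 0 := by
  have := h.isFiniteMeasureOnCompacts
  have hO : IsOpen (closure A)ᶜ := isClosed_closure.isOpen_compl
  have hν1 : ∀ᵐ x ∂ρ, ‖ν x‖ ≤ 1 := h.norm_eq_one.mono fun x hx => hx.le
  have hc (v : Euc N) : ∀ᵐ x ∂ρ, x ∈ (closure A)ᶜ → ⟪ν x, v⟫ = 0 := by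
    refine hO.ae_eq_zero_of_integral_contDiff_smul_eq_zero ?_ fun g hg hgc hgs => ?_
    · refine LocallyIntegrable.locallyIntegrableOn ?_ _
      refine (locallyIntegrable_const ‖v‖).mono (h.measurable.inner_const).aestronglyMeasurable ?_
      filter_upwards [hν1] with x hx
      calc ‖⟪ν x, v⟫‖ ≤ ‖ν x‖ * ‖v‖ := norm_inner_le_norm _ _
        _ ≤ 1 * ‖v‖ := by gcongr
        _ = ‖‖v‖‖ := by simp
    · have h1 := h.integral_eq g hg hgc (Set.subset_univ _) v
      have h2 (x : Euc N) : A.indicator (fun _ => (1 : ℝ)) x * fderiv ℝ g x v = 0 := by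
        by_cases hx : x ∈ A
        · rw [image_eq_zero_of_notMem_tsupport fun hx' =>
            hgs (tsupport_fderiv_subset ℝ hx') (subset_closure hx)]
          simp
        · simp [hx]
      simp only [h2, integral_zero, smul_eq_mul] at h1 ⊢
      linarith
  have hall : ∀ᵐ x ∂ρ, ∀ i, x ∈ (closure A)ᶜ → ⟪ν x, EuclideanSpace.single i (1 : ℝ)⟫ = 0 :=
    ae_all_iff.2 fun i => hc _
  have hae : ∀ᵐ x ∂ρ, x ∉ (closure A)ᶜ := by
    filter_upwards [hall, h.norm_eq_one] with x hx h1 hxA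
    have h0 : ν x = 0 := by
      ext i
      simpa [EuclideanSpace.inner_single_right] using hx i hxA
    simp [h0] at h1
  exact measure_eq_zero_iff_ae_notMem.2 hae

/-- The gradient of `u + c f`, where `Du = G dx` and where `Df` lives on a closed set on which `G`
vanishes: the two gradients are mutually singular, so that the polar forms can be glued. -/
lemma HasWeakGradient.hasPolarGradient_add {u : Euc N → ℝ} {G : Euc N → Euc N}
    (hw : HasWeakGradient u G) (hu : LocallyIntegrable u volume) (hG : Integrable G volume)
    (hGm : Measurable G) {K : Set (Euc N)} [DecidablePred (· ∈ K)] (hK : MeasurableSet K)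
    (hGK : ∀ x ∈ K, G x = 0)
    {f : Euc N → ℝ} (hf : LocallyIntegrable f volume) {ρ : Measure (Euc N)} {ν : Euc N → Euc N}
    (h : HasPolarGradient Set.univ f ρ ν) (hρK : ρ Kᶜ = 0) {σ : ℝ} (hσ : |σ| = 1) (k : ℝ≥0) :
    HasPolarGradient Set.univ (fun x => u x + σ * k * f x)
      (k • ρ + volume.withDensity fun x => (‖G x‖₊ : ℝ≥0∞))
      (fun x => if x ∈ K then σ • ν x else ‖G x‖⁻¹ • G x) := by
  have := h.isFiniteMeasureOnCompacts
  have hGn : Measurable fun x => ‖G x‖₊ := hGm.nnnorm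
  have hfin : IsFiniteMeasure (volume.withDensity fun x => (‖G x‖₊ : ℝ≥0∞)) :=
    isFiniteMeasure_withDensity hG.2.ne
  have hm : Measurable (fun x => if x ∈ K then σ • ν x else ‖G x‖⁻¹ • G x) :=
    Measurable.ite hK (h.measurable.const_smul σ) (hGm.norm.inv.smul hGm)
  have hKae : ∀ᵐ x ∂ρ, x ∈ K := by simpa [ae_iff] using! hρK
  have hn1 : ∀ᵐ x ∂ρ, ‖if x ∈ K then σ • ν x else ‖G x‖⁻¹ • G x‖ = 1 := by
    filter_upwards [hKae, h.norm_eq_one] with x hx h1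
    rw [if_pos hx, norm_smul, h1, Real.norm_eq_abs, hσ, one_mul]
  have hn2 : ∀ᵐ x ∂(volume.withDensity fun x => (‖G x‖₊ : ℝ≥0∞)),
      ‖if x ∈ K then σ • ν x else ‖G x‖⁻¹ • G x‖ = 1 := by
    rw [ae_withDensity_iff hGn.coe_nnreal_ennreal]
    refine Eventually.of_forall fun x hx => ?_
    have hx0 : G x ≠ 0 := by simpa using hx
    rw [if_neg fun hxK => hx0 (hGK x hxK), norm_smul, norm_inv, norm_norm,
      inv_mul_cancel₀ (norm_ne_zero_iff.2 hx0)]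
  refine ⟨by simp, fun C hC _ => ?_, hm, ?_, fun η hη hc _ v => ?_⟩
  · rw [Measure.add_apply]
    exact ENNReal.add_lt_top.2 ⟨ENNReal.mul_lt_top ENNReal.coe_lt_top hC.measure_lt_top,
      measure_lt_top _ _⟩
  · exact ae_add_measure_iff.2 ⟨Measure.ae_smul_measure hn1 _, hn2⟩
  · have i1 := integrable_mul_inner hm (hn1.mono fun x hx => hx.le) hη.continuous hc v
    have i2 := integrable_mul_inner hm (hn2.mono fun x hx => hx.le) hη.continuous hc v
    have hη'c := continuous_fderiv_apply_const hη v
    have hη's := hasCompactSupport_fderiv_apply_const hc v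
    rw [integral_add_measure (i1.smul_measure_nnreal) i2, integral_smul_nnreal_measure,
      integral_withDensity_eq_integral_smul hGn]
    have e1 : ∫ x, η x * ⟪if x ∈ K then σ • ν x else ‖G x‖⁻¹ • G x, v⟫ ∂ρ
        = σ * ∫ x, η x * ⟪ν x, v⟫ ∂ρ := by
      rw [← integral_const_mul]
      refine integral_congr_ae ?_
      filter_upwards [hKae] with x hx
      rw [if_pos hx, real_inner_smul_left]
      ring
    have e2 : ∫ x, ‖G x‖₊ • (η x * ⟪if x ∈ K then σ • ν x else ‖G x‖⁻¹ • G x, v⟫)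
        = ∫ x, η x * ⟪G x, v⟫ := by
      congr with x
      by_cases hx0 : G x = 0
      · simp [hx0]
      rw [if_neg fun hxK => hx0 (hGK x hxK), real_inner_smul_left, NNReal.smul_def, coe_nnnorm,
        smul_eq_mul]
      have := norm_ne_zero_iff.2 hx0
      field_simp
    have e3 : ∫ x in Set.univ, (u x + σ * k * f x) * fderiv ℝ η x v
        = (∫ x, u x * fderiv ℝ η x v) + σ * k * ∫ x, f x * fderiv ℝ η x v := by
      rw [setIntegral_univ, ← integral_const_mul,
        ← integral_add (integrable_mul_of_hasCompactSupport hu hη'c hη's)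
          ((integrable_mul_of_hasCompactSupport hf hη'c hη's).const_mul _)]
      congr with x
      ring
    have e4 := h.integral_eq η hη hc (Set.subset_univ _) v
    rw [setIntegral_univ] at e4
    rw [e1, e2, e3, hw η hη hc v, e4, NNReal.smul_def, smul_eq_mul]
    ring

/-! ### Lipschitz boundaries are negligible -/

lemma volume_graph_eq_zero {g : Euc N → ℝ} (hg : Continuous g) {e : Euc N} (he : ‖e‖ = 1) :
    volume {y : Euc N | g (y - ⟪e, y⟫ • e) = ⟪e, y⟫} = 0 := by
  refine Measure.addHaar_eq_zero_of_disjoint_translates volume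
    (fun n : ℕ => (1 / ((n : ℝ) + 1)) • e) ?_ ?_ ?_
  · refine (Metric.isBounded_closedBall (x := (0 : Euc N)) (r := 1)).subset ?_
    rintro _ ⟨n, rfl⟩
    simp only [mem_closedBall_zero_iff, norm_smul, he, mul_one]
    rw [Real.norm_of_nonneg (by positivity)]
    exact (div_le_one (by positivity)).2 (by linarith [(Nat.cast_nonneg n : (0 : ℝ) ≤ n)])
  · intro m n hmn
    rw [Function.onFun, Set.disjoint_left]
    have key (s : ℝ) (y z : Euc N) (hz : g (z - ⟪e, z⟫ • e) = ⟪e, z⟫) (hy : s • e + z = y) :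
        g (y - ⟪e, y⟫ • e) + s = ⟪e, y⟫ := by
      subst hy
      have h1 : ⟪e, s • e + z⟫ = s + ⟪e, z⟫ := by
        rw [inner_add_right, real_inner_smul_right, real_inner_self_eq_norm_sq, he]
        ring
      have h2 : s • e + z - (s + ⟪e, z⟫) • e = z - ⟪e, z⟫ • e := by
        rw [add_smul]; abel
      rw [h1, h2, hz, add_comm]
    intro y hy1 hy2
    simp only [Set.singleton_add, Set.mem_image, Set.mem_ofPred_eq] at hy1 hy2
    obtain ⟨z1, hz1, h1⟩ := hy1
    obtain ⟨z2, hz2, h2⟩ := hy2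
    have h3 := key _ y z1 hz1 h1
    have h4 := key _ y z2 hz2 h2
    have h5 : 1 / ((m : ℝ) + 1) = 1 / ((n : ℝ) + 1) := by linarith
    rw [one_div, one_div, inv_inj] at h5
    exact hmn (by exact_mod_cast add_right_cancel h5)
  · exact (isClosed_eq (hg.comp (by fun_prop)) (by fun_prop)).measurableSet

lemma volume_frontier_eq_zero {Ω : Set (Euc N)} (hΩ : IsOpen Ω) (h : HasLipschitzBoundary Ω) :
    volume (frontier Ω) = 0 := by
  refine measure_null_of_locally_null _ fun x hx => ?_
  obtain ⟨e, V, g, L, he, hV, hxV, hg, hΩV⟩ := h x hx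
  refine ⟨frontier Ω ∩ V, inter_mem_nhdsWithin _ (hV.mem_nhds hxV), ?_⟩
  refine measure_mono_null ?_ (volume_graph_eq_zero hg.continuous he)
  rintro y ⟨hyF, hyV⟩
  rw [hΩ.frontier_eq] at hyF
  have hc : Continuous fun y : Euc N => g (y - ⟪e, y⟫ • e) := hg.continuous.comp (by fun_prop)
  have hi : Continuous fun y : Euc N => ⟪e, y⟫ := by fun_prop
  refine le_antisymm (not_lt.1 fun hlt => ?_) (not_lt.1 fun hlt => ?_)
  · obtain ⟨z, ⟨hzV, hz⟩, hzΩ⟩ := mem_closure_iff.1 hyF.1 (V ∩ {z | ⟪e, z⟫ < g (z - ⟪e, z⟫ • e)})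
      (hV.inter (isOpen_lt hi hc)) ⟨hyV, hlt⟩
    have : z ∈ {y | y ∈ V ∧ g (y - ⟪e, y⟫ • e) < ⟪e, y⟫} := hΩV ▸ ⟨hzΩ, hzV⟩
    exact lt_asymm hz this.2
  · have : y ∈ Ω ∩ V := hΩV ▸ ⟨hyV, hlt⟩
    exact hyF.2 this.1

/-! ### Bounds for the anisotropic total variation -/

lemma HasWeakGradient.congr_ae {u : Euc N → ℝ} {G G' : Euc N → Euc N} (h : HasWeakGradient u G)
    (hG : G =ᵐ[volume] G') : HasWeakGradient u G' := by
  intro η hη hc v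
  rw [h η hη hc v]
  congr 1
  refine integral_congr_ae ?_
  filter_upwards [hG] with x hx
  rw [hx]

lemma HasPolarGradient.congr_ae {u u' : Euc N → ℝ} {ρ : Measure (Euc N)} {ν : Euc N → Euc N}
    (h : HasPolarGradient Set.univ u ρ ν) (hu : u =ᵐ[volume] u') :
    HasPolarGradient Set.univ u' ρ ν where
  compl_eq_zero := h.compl_eq_zero
  lt_top_of_isCompact := h.lt_top_of_isCompact
  measurable := h.measurable
  norm_eq_one := h.norm_eq_one
  integral_eq η hη hc hs v := by
    rw [← h.integral_eq η hη hc hs v]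
    refine integral_congr_ae ?_
    filter_upwards [ae_restrict_of_ae hu] with x hx
    rw [hx]

/-- For `w = u + σ k f` with mutually singular gradients `G dx` and `Df`, the anisotropic variation
of `w` is controlled by that of `σ f`, with the sharp factor `k`. -/
lemma anisoTV_le {φ : Euc N → Euc N → ℝ} (hφ : IsAdmissibleIntegrand φ) {β : ℝ}
    (hβ : ∀ x ξ, φ x ξ ≤ β * ‖ξ‖) {u : Euc N → ℝ} {G : Euc N → Euc N}
    (hw : HasWeakGradient u G) (hu : LocallyIntegrable u volume) (hG : Integrable G volume)
    (hGm : Measurable G) {K : Set (Euc N)} (hK : MeasurableSet K)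
    (hGK : ∀ x ∈ K, G x = 0)
    {f : Euc N → ℝ} (hf : LocallyIntegrable f volume) {ρ : Measure (Euc N)} {ν : Euc N → Euc N}
    (h : HasPolarGradient Set.univ f ρ ν) (hρK : ρ Kᶜ = 0) {σ : ℝ} (hσ : |σ| = 1) (k : ℝ≥0)
    {w : Euc N → ℝ} (hwu : (fun x => u x + σ * k * f x) =ᵐ[volume] w) (B : Set (Euc N)) :
    anisoTV φ w B ≤ k * ∫⁻ x, ENNReal.ofReal (φ x (σ • ν x)) ∂ρ
      + ENNReal.ofReal β * ∫⁻ x, ‖G x‖ₑ := by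
  classical
  have hpol := (hw.hasPolarGradient_add hu hG hGm hK hGK hf h hρK hσ k).congr_ae hwu
  have hloc : LocallyIntegrable w volume := by
    refine (hu.add (hf.smul (σ * k))).congr ?_
    simpa using! hwu
  have hKae : ∀ᵐ x ∂ρ, x ∈ K := measure_eq_zero_iff_ae_notMem.1 hρK |>.mono fun x hx => by
    simpa using hx
  have hmeas : Measurable fun x =>
      ENNReal.ofReal (φ x (if x ∈ K then σ • ν x else ‖G x‖⁻¹ • G x)) :=
    (hφ.measurable.comp (measurable_id.prodMk hpol.measurable)).ennreal_ofReal
  refine iInf₂_le_of_le _ _ (iInf_le_of_le ⟨hloc, hpol⟩ ?_)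
  refine (setLIntegral_le_lintegral _ _).trans ?_
  rw [lintegral_add_measure]
  refine add_le_add (le_of_eq ?_) ?_
  · rw [lintegral_smul_measure, ENNReal.smul_def, smul_eq_mul]
    congr 1
    refine lintegral_congr_ae ?_
    filter_upwards [hKae] with x hx
    rw [if_pos hx]
  · rw [lintegral_withDensity_eq_lintegral_mul _ hGm.nnnorm.coe_nnreal_ennreal hmeas,
      ← lintegral_const_mul _ hGm.enorm]
    refine lintegral_mono fun x => ?_
    by_cases hx0 : G x = 0
    · simp [hx0]
    rw [Pi.mul_apply, if_neg fun hxK => hx0 (hGK x hxK), mul_comm]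
    refine mul_le_mul_left (ENNReal.ofReal_le_ofReal ?_) _
    have h1 := hβ x (‖G x‖⁻¹ • G x)
    rwa [norm_smul, norm_inv, norm_norm, inv_mul_cancel₀ (norm_ne_zero_iff.2 hx0), mul_one] at h1

/-! ### Functions of bounded variation on `Ω` and their approximate limits -/

lemma HasPolarGradient.memBV {u : Euc N → ℝ} {ρ : Measure (Euc N)} {ν : Euc N → Euc N}
    (h : HasPolarGradient Set.univ u ρ ν) {Ω : Set (Euc N)} (hΩ : IsOpen Ω)
    (hb : Bornology.IsBounded Ω) (hu : IntegrableOn u Ω volume) : MemBV Ω u := by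
  refine ⟨hu, _, _, h.restrict hΩ.measurableSet, ?_⟩
  exact (Measure.restrict_apply_le _ _).trans_lt ((measure_mono subset_closure).trans_lt
    (h.lt_top_of_isCompact _ hb.isCompact_closure (Set.subset_univ _)))

/-- Since `√(1 + v²)` has bounded derivative in `v`, it maps `W^{1,1}(ℝ^N)` to `BV(Ω)`. It is used
as a smooth substitute for `|v|`. -/
lemma HasWeakGradient.memBV_sqrt {u : Euc N → ℝ} {G : Euc N → Euc N}
    (hw : HasWeakGradient u G) (hu : Integrable u volume) (hG : Integrable G volume)
    {Ω : Set (Euc N)} (hΩ : IsOpen Ω) (hb : Bornology.IsBounded Ω) :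
    MemBV Ω fun x => √(1 + u x ^ 2) := by
  classical
  set h : ℝ → ℝ := fun t => √(1 + t ^ 2) with hdef
  have hpos (t : ℝ) : 0 < 1 + t ^ 2 := by positivity
  have hh : ContDiff ℝ (⊤ : ℕ∞) h :=
    ContDiff.sqrt (by fun_prop) fun t => (hpos t).ne'
  have hder (t : ℝ) : deriv h t = t / √(1 + t ^ 2) := by
    have h1 : HasDerivAt (fun t : ℝ => 1 + t ^ 2) (2 * t) t := by
      simpa using (hasDerivAt_pow 2 t).const_add 1
    rw [(h1.sqrt (hpos t).ne').deriv]
    exact mul_div_mul_left _ _ two_ne_zero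
  have hh' (t : ℝ) : |deriv h t| ≤ 1 := by
    rw [hder, abs_div, abs_of_nonneg (Real.sqrt_nonneg _)]
    exact div_le_one_of_le₀ (Real.abs_le_sqrt (by linarith)) (Real.sqrt_nonneg _)
  have hF : Integrable (fun x => deriv h (u x) • G x) volume :=
    hG.bdd_smul 1 ((hh.continuous_deriv (by simp)).comp_aestronglyMeasurable
      hu.aestronglyMeasurable) (Eventually.of_forall fun x => hh' _)
  have hmk := hF.aestronglyMeasurable.ae_eq_mk
  have hV : Integrable (fun x => √(1 + u x ^ 2)) (volume.restrict Ω) := by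
    have : IsFiniteMeasure (volume.restrict Ω) := ⟨by simpa using hb.measure_lt_top⟩
    refine ((integrable_const (1 : ℝ)).add hu.abs.integrableOn).mono'
      (hh.continuous.comp_aestronglyMeasurable hu.aestronglyMeasurable.restrict)
      (Eventually.of_forall fun x => ?_)
    rw [Real.norm_of_nonneg (Real.sqrt_nonneg _), Pi.add_apply]
    refine Real.sqrt_le_iff.2 ⟨by positivity, ?_⟩
    nlinarith [abs_nonneg (u x), sq_abs (u x)]
  have hVl : LocallyIntegrable (fun x => √(1 + u x ^ 2)) volume := by
    refine ((locallyIntegrable_const (1 : ℝ)).add hu.abs.locallyIntegrable).mono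
      (hh.continuous.comp_aestronglyMeasurable hu.aestronglyMeasurable)
      (Eventually.of_forall fun x => ?_)
    rw [Real.norm_of_nonneg (Real.sqrt_nonneg _), Pi.add_apply, Real.norm_of_nonneg (by positivity)]
    refine Real.sqrt_le_iff.2 ⟨by positivity, ?_⟩
    nlinarith [abs_nonneg (u x), sq_abs (u x)]
  have hpol := ((hw.comp_contDiff hu hG hh hh').congr_ae hmk).hasPolarGradient_add
    hVl (hF.congr hmk) hF.aestronglyMeasurable.stronglyMeasurable_mk.measurable
    MeasurableSet.empty (by simp) (locallyIntegrable_const 0) hasPolarGradient_zero (by simp)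
    (abs_one (α := ℝ)) 0
  simp only [NNReal.coe_zero, mul_zero, add_zero] at hpol
  exact hpol.memBV hΩ hb hV

/-- The approximate limits of a `W^{1,1}`-function `u` lie between `±V⁺` with `V = √(1 + u²)`, and
`V` is a non-negative function in `BV(Ω)`. -/
lemma IsAdmissibleMeasure.integrable_approx {Ω : Set (Euc N)} {μ : Measure (Euc N)}
    (hμ : IsAdmissibleMeasure Ω μ) (hΩ : IsOpen Ω) (hb : Bornology.IsBounded Ω)
    {u : Euc N → ℝ} {G : Euc N → Euc N} (hw : HasWeakGradient u G) (hu : Integrable u volume)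
    (hG : Integrable G volume) :
    IntegrableOn (fun x => (approxUpper Ω u x).toReal) Ω μ ∧
      IntegrableOn (fun x => (approxLower Ω u x).toReal) Ω μ := by
  set V : Euc N → ℝ := fun x => √(1 + u x ^ 2) with hVdef
  have hV := hw.memBV_sqrt hu hG hΩ hb
  have hlt := hμ.lintegral_lt_top V hV (Eventually.of_forall fun x => Real.sqrt_nonneg _)
  have hVu (x : Euc N) : |u x| ≤ V x := Real.abs_le_sqrt (by linarith)
  have hVm : AEMeasurable V volume :=
    ((hu.aestronglyMeasurable.aemeasurable.pow_const 2).const_add 1).sqrt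
  have hVUm := measurable_approxUpper Ω V
  have hVi : Integrable (fun x => (approxUpper Ω V x).toENNReal.toReal) (μ.restrict Ω) :=
    integrable_toReal_of_lintegral_ne_top hVUm.ereal_toENNReal.aemeasurable hlt.ne
  have hfin : ∀ᵐ x ∂(μ.restrict Ω), (approxUpper Ω V x).toENNReal < ⊤ :=
    ae_lt_top hVUm.ereal_toENNReal hlt.ne
  have hbd {a b : EReal} (hb : b.toENNReal < ⊤) (h1 : a ≤ b) (h2 : -b ≤ a) :
      ‖a.toReal‖ ≤ b.toENNReal.toReal := by
    induction b with
    | bot => simp_all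
    | top => simp at hb
    | coe b =>
      have ht : a ≠ ⊤ := fun h => by simp [h] at h1
      have hbot : a ≠ ⊥ := fun h => by
        rw [h, ← EReal.coe_neg] at h2
        exact EReal.coe_ne_bot _ (le_bot_iff.1 h2)
      lift a to ℝ using ⟨ht, hbot⟩
      rw [← EReal.coe_neg, EReal.coe_le_coe_iff] at h2
      rw [EReal.coe_le_coe_iff] at h1
      rw [EReal.toReal_coe, EReal.toENNReal_of_ne_top (EReal.coe_ne_top b), EReal.toReal_coe,
        ENNReal.toReal_ofReal (by linarith)]
      exact abs_le.2 ⟨by linarith, h1⟩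
  have hup (x : Euc N) : approxUpper Ω u x ≤ approxUpper Ω V x :=
    approxUpper_mono (fun y _ => (le_abs_self _).trans (hVu y)) x
  have hlow {x : Euc N} (hx : x ∈ Ω) : -approxUpper Ω V x ≤ approxLower Ω u x :=
    neg_approxUpper_le_approxLower hΩ (nullMeasurableSet_superlevel hΩ hVm) hVu hx
  constructor
  · refine hVi.mono' (measurable_approxUpper Ω u).ereal_toReal.aestronglyMeasurable ?_
    filter_upwards [hfin, ae_restrict_mem hΩ.measurableSet] with x hx hxΩ
    exact hbd hx (hup x) ((hlow hxΩ).trans (approxLower_le_approxUpper _ _ _))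
  · refine hVi.mono' (measurable_approxLower hΩ hu.aestronglyMeasurable.aemeasurable
      ).ereal_toReal.aestronglyMeasurable ?_
    filter_upwards [hfin, ae_restrict_mem hΩ.measurableSet] with x hx hxΩ
    exact hbd hx ((approxLower_le_approxUpper _ _ _).trans (hup x)) (hlow hxΩ)

section AddIndicator

variable {Ω A S : Set (Euc N)} {v : Euc N → ℝ} {c : ℝ}

lemma eventuallyEq_add_indicator_of_notMem {x : Euc N} (hx : x ∉ closure A) :
    (fun y => v y + A.indicator (fun _ => c) y) =ᶠ[𝓝 x] v := by
  filter_upwards [isClosed_closure.isOpen_compl.mem_nhds hx] with y hy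
  rw [Set.indicator_of_notMem fun h => hy (subset_closure h), add_zero]

lemma eventuallyEq_add_indicator_of_mem {x : Euc N} (hx : v =ᶠ[𝓝 x] 0) :
    (fun y => v y + A.indicator (fun _ => c) y) =ᶠ[𝓝 x] A.indicator fun _ => c := by
  filter_upwards [hx] with y hy
  rw [hy, Pi.zero_apply, zero_add]

lemma approxUpper_toReal_eq_zero (hΩ : IsOpen Ω) {x : Euc N} (hx : x ∈ Ω) (hv : v =ᶠ[𝓝 x] 0) :
    (approxUpper Ω v x).toReal = 0 := by
  classical
  have h0 : v =ᶠ[𝓝 x] (∅ : Set (Euc N)).indicator fun _ => 1 := by simpa using! hv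
  rw [approxUpper_congr h0, approxUpper_indicator_pos hΩ hx one_pos,
    if_neg (notMem_measureClosure_empty x)]
  simp

lemma approxLower_toReal_eq_zero (hΩ : IsOpen Ω) {x : Euc N} (hx : x ∈ Ω) (hv : v =ᶠ[𝓝 x] 0) :
    (approxLower Ω v x).toReal = 0 := by
  classical
  have h0 : v =ᶠ[𝓝 x] (∅ : Set (Euc N)).indicator fun _ => 1 := by simpa using! hv
  rw [approxLower_congr h0, approxLower_indicator_pos hΩ hx one_pos,
    if_neg fun h => notMem_measureClosure_empty x (measureInterior_subset_measureClosure _ h)]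
  simp

/-- If `v` vanishes near the closure of `A`, then the approximate upper limits of `v` and `c 𝟙_A`
add up. -/
lemma approxUpper_add_indicator [DecidablePred (· ∈ S)] (hΩ : IsOpen Ω)
    (hv : ∀ x ∈ closure A, v =ᶠ[𝓝 x] 0) (hS : S ⊆ closure A)
    (hc : ∀ x ∈ Ω, approxUpper Ω (A.indicator fun _ => c) x = ((if x ∈ S then c else 0 : ℝ) : EReal))
    {x : Euc N} (hx : x ∈ Ω) :
    (approxUpper Ω (fun y => v y + A.indicator (fun _ => c) y) x).toReal
      = (approxUpper Ω v x).toReal + S.indicator (fun _ => c) x := by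
  by_cases hxA : x ∈ closure A
  · rw [approxUpper_congr (eventuallyEq_add_indicator_of_mem (hv x hxA)), hc x hx,
      approxUpper_toReal_eq_zero hΩ hx (hv x hxA), EReal.toReal_coe, zero_add, Set.indicator_apply]
  · rw [approxUpper_congr (eventuallyEq_add_indicator_of_notMem hxA),
      Set.indicator_of_notMem fun h => hxA (hS h), add_zero]

lemma approxLower_add_indicator [DecidablePred (· ∈ S)] (hΩ : IsOpen Ω)
    (hv : ∀ x ∈ closure A, v =ᶠ[𝓝 x] 0) (hS : S ⊆ closure A)
    (hc : ∀ x ∈ Ω, approxLower Ω (A.indicator fun _ => c) x = ((if x ∈ S then c else 0 : ℝ) : EReal))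
    {x : Euc N} (hx : x ∈ Ω) :
    (approxLower Ω (fun y => v y + A.indicator (fun _ => c) y) x).toReal
      = (approxLower Ω v x).toReal + S.indicator (fun _ => c) x := by
  by_cases hxA : x ∈ closure A
  · rw [approxLower_congr (eventuallyEq_add_indicator_of_mem (hv x hxA)), hc x hx,
      approxLower_toReal_eq_zero hΩ hx (hv x hxA), EReal.toReal_coe, zero_add, Set.indicator_apply]
  · rw [approxLower_congr (eventuallyEq_add_indicator_of_notMem hxA),
      Set.indicator_of_notMem fun h => hxA (hS h), add_zero]

end AddIndicator

/-! ### The competitors and the isoperimetric inequality -/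

/-- Cutting `u₀` off near a compact subset `K` of `Ω` yields a `W^{1,1}`-function which agrees with
`u₀` outside `Ω`. -/
lemma MemW11.exists_cutoff {u₀ : Euc N → ℝ} (hu₀ : MemW11 u₀) {Ω K : Set (Euc N)}
    (hb : Bornology.IsBounded Ω) (hΩ : IsOpen Ω) (hK : IsClosed K) (hKΩ : K ⊆ Ω) :
    ∃ (v : Euc N → ℝ) (G : Euc N → Euc N), Integrable v volume ∧ Integrable G volume ∧
      Measurable G ∧ HasWeakGradient v G ∧ (∀ x ∈ K, v =ᶠ[𝓝 x] 0) ∧ (∀ x ∈ K, G x = 0) ∧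
      ∀ x ∉ Ω, v x = u₀ x := by
  obtain ⟨hu, G₀, hG₀, hw : HasWeakGradient u₀ G₀⟩ := hu₀
  obtain ⟨ψ, hψ0, hψ1, hψ⟩ := exists_contMDiffMap_zero_one_nhds_of_isClosed
    (n := (⊤ : ℕ∞)) (modelWithCornersSelf ℝ (Euc N)) hK hΩ.isClosed_compl
    (Set.disjoint_compl_right_iff_subset.2 hKΩ)
  have hψs : ContDiff ℝ (⊤ : ℕ∞) (ψ : Euc N → ℝ) := ψ.contMDiff.contDiff
  rw [eventually_nhdsSet_iff_forall] at hψ0 hψ1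
  have hgc : Continuous (gradient (ψ : Euc N → ℝ)) :=
    (InnerProductSpace.toDual ℝ (Euc N)).symm.continuous.comp (hψs.continuous_fderiv (by simp))
  have hgs : HasCompactSupport (gradient (ψ : Euc N → ℝ)) := by
    refine HasCompactSupport.intro hb.isCompact_closure fun x hx => ?_
    have h1 : (ψ : Euc N → ℝ) =ᶠ[𝓝 x] fun _ => 1 := hψ1 x fun h => hx (subset_closure h)
    rw [gradient, h1.fderiv_eq]
    simp
  obtain ⟨C, hC⟩ := hgc.bounded_above_of_compact_support hgs
  have hF : Integrable (fun x => ψ x • G₀ x + u₀ x • gradient ψ x) volume := by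
    refine (hG₀.bdd_smul 1 hψs.continuous.aestronglyMeasurable
      (Eventually.of_forall fun x => ?_)).add
      (hu.smul_bdd C hgc.aestronglyMeasurable (Eventually.of_forall hC))
    rw [Real.norm_of_nonneg (hψ x).1]
    exact (hψ x).2
  have hv : Integrable (fun x => ψ x * u₀ x) volume := by
    refine hu.bdd_mul (c := 1) hψs.continuous.aestronglyMeasurable
      (Eventually.of_forall fun x => ?_)
    rw [Real.norm_of_nonneg (hψ x).1]
    exact (hψ x).2
  have hFm := hF.aestronglyMeasurable.stronglyMeasurable_mk.measurable
  have hF0 (x : Euc N) (hx : x ∈ K) : ψ x • G₀ x + u₀ x • gradient ψ x = 0 := by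
    have h1 : (ψ : Euc N → ℝ) =ᶠ[𝓝 x] fun _ => 0 := hψ0 x hx
    have h2 : gradient (ψ : Euc N → ℝ) x = 0 := by
      rw [gradient, h1.fderiv_eq]
      simp
    rw [h2, h1.self_of_nhds]
    simp
  have hae : (fun x => ψ x • G₀ x + u₀ x • gradient ψ x) =ᵐ[volume]
      Kᶜ.indicator (hF.aestronglyMeasurable.mk _) := by
    filter_upwards [hF.aestronglyMeasurable.ae_eq_mk] with x hx
    by_cases hxK : x ∈ K
    · simp [hxK, hF0 x hxK]
    · rw [Set.indicator_of_mem hxK, hx]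
  refine ⟨fun x => ψ x * u₀ x, Kᶜ.indicator (hF.aestronglyMeasurable.mk _), hv, hF.congr hae,
    hFm.indicator hK.isOpen_compl.measurableSet,
    (hw.mul_contDiff hu.locallyIntegrable hG₀.locallyIntegrable hψs).congr_ae hae, fun x hx => ?_,
    fun x hx => by simp [hx], fun x hx => ?_⟩
  · filter_upwards [hψ0 x hx] with y hy
    simp [hy]
  · change ψ x * u₀ x = u₀ x
    rw [(hψ1 x hx).self_of_nhds, one_mul]

lemma nonneg_of_forall_le_natCast_mul_add {m D E : ℝ} (h : ∀ k : ℕ, 0 < k → m ≤ k * D + E) :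
    0 ≤ D := by
  by_contra! hD
  obtain ⟨k, hk⟩ := exists_nat_gt ((E - m) / -D)
  have hk1 := h (k + 1) k.succ_pos
  rw [div_lt_iff₀ (by linarith)] at hk
  push_cast at hk1
  nlinarith

/-- The isoperimetric inequality obtained from the competitors `v + σ k 𝟙_A`, `k → ∞`, for a sign
`σ = ±1`. Here `S` and `S'` are the sets on which the approximate upper and lower limit of
`σ k 𝟙_A` equal `σ k`. -/
lemma isoperimetric_of_bddBelow {Ω : Set (Euc N)} (hΩ : IsOpen Ω) (hb : Bornology.IsBounded Ω)
    (hlip : HasLipschitzBoundary Ω) {φ : Euc N → Euc N → ℝ} (hφ : IsAdmissibleIntegrand φ)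
    {μp μm : Measure (Euc N)} (hμp : IsAdmissibleMeasure Ω μp) (hμm : IsAdmissibleMeasure Ω μm)
    {u₀ : Euc N → ℝ} (hu₀ : MemW11 u₀) {m : ℝ}
    (hm : ∀ w : Euc N → ℝ, MemBV Ω w → m ≤ functional φ Ω u₀ μp μm w)
    {A : Set (Euc N)} (hA : NullMeasurableSet A volume) (hAΩ : CompactlyContained A Ω)
    {ρ : Measure (Euc N)} {ν : Euc N → Euc N}
    (hρ : HasPolarGradient Set.univ (A.indicator fun _ => (1 : ℝ)) ρ ν)
    {σ : ℝ} (hσ : |σ| = 1) {S S' : Set (Euc N)} [DecidablePred (· ∈ S)] [DecidablePred (· ∈ S')]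
    (hS : MeasurableSet S) (hS' : MeasurableSet S') (hSA : S ⊆ closure A) (hSA' : S' ⊆ closure A)
    (hup : ∀ k : ℝ, 0 < k → ∀ x ∈ Ω,
      approxUpper Ω (A.indicator fun _ => σ * k) x = ((if x ∈ S then σ * k else 0 : ℝ) : EReal))
    (hlow : ∀ k : ℝ, 0 < k → ∀ x ∈ Ω,
      approxLower Ω (A.indicator fun _ => σ * k) x = ((if x ∈ S' then σ * k else 0 : ℝ) : EReal)) :
    ∫⁻ x, ENNReal.ofReal (φ x (σ • ν x)) ∂ρ ≠ ⊤ ∧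
    0 ≤ (∫⁻ x, ENNReal.ofReal (φ x (σ • ν x)) ∂ρ).toReal + σ * (μp.real S' - μm.real S) := by
  obtain ⟨hAc, hAsub⟩ := hAΩ
  obtain ⟨α, β, hα, hαβ, hcomp⟩ := hφ.comparable
  obtain ⟨v, G, hv, hG, hGm, hw, hv0, hG0, hvu⟩ :=
    hu₀.exists_cutoff hb hΩ isClosed_closure hAsub
  have hρK := hρ.measure_compl_closure
  have hβ (x ξ : Euc N) : φ x ξ ≤ β * ‖ξ‖ := (hcomp x ξ).2
  set T := ∫⁻ x, ENNReal.ofReal (φ x (σ • ν x)) ∂ρ with hT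
  have hTfin : T ≠ ⊤ := by
    have hρfin : ρ Set.univ < ⊤ := by
      rw [← measure_add_measure_compl isClosed_closure.measurableSet, hρK, add_zero]
      exact hρ.lt_top_of_isCompact _ hAc (Set.subset_univ _)
    have hle : T ≤ ∫⁻ _, ENNReal.ofReal β ∂ρ := by
      refine lintegral_mono_ae ?_
      filter_upwards [hρ.norm_eq_one] with x hx
      have := hβ x (σ • ν x)
      rw [norm_smul, hx, Real.norm_eq_abs, hσ, mul_one, mul_one] at this
      exact ENNReal.ofReal_le_ofReal this
    rw [lintegral_const] at hle
    exact (hle.trans_lt (ENNReal.mul_lt_top ENNReal.ofReal_lt_top hρfin)).ne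
  refine ⟨hTfin, ?_⟩
  set C := ENNReal.ofReal β * ∫⁻ x, ‖G x‖ₑ with hC
  have hCfin : C ≠ ⊤ := (ENNReal.mul_lt_top ENNReal.ofReal_lt_top hG.2).ne
  have h1A : LocallyIntegrable (A.indicator fun _ => (1 : ℝ)) volume := by
    have hA0 : volume A ≠ ⊤ := ((measure_mono subset_closure).trans_lt hAc.measure_lt_top).ne
    refine Integrable.locallyIntegrable ?_
    exact (integrableOn_const hA0).integrable_indicator₀ hA
  have hSμ {μ : Measure (Euc N)} (hμ : IsAdmissibleMeasure Ω μ) {S : Set (Euc N)}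
      (hSA : S ⊆ closure A) : μ S ≠ ⊤ :=
    ((measure_mono hSA).trans_lt (hμ.lt_top_of_isCompact _ hAc hAsub)).ne
  have hint {μ : Measure (Euc N)} (hμ : IsAdmissibleMeasure Ω μ) {S : Set (Euc N)}
      (hS : MeasurableSet S) (hSA : S ⊆ closure A) {f g : Euc N → ℝ} {c : ℝ}
      (hg : IntegrableOn g Ω μ) (hfg : ∀ x ∈ Ω, f x = g x + S.indicator (fun _ => c) x) :
      ∫ x in Ω, f x ∂μ = ∫ x in Ω, g x ∂μ + c * μ.real S := by
    rw [setIntegral_congr_fun hΩ.measurableSet hfg, integral_add hg, integral_indicator hS,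
      Measure.restrict_restrict hS, Set.inter_eq_left.2 (hSA.trans hAsub), setIntegral_const,
      smul_eq_mul, mul_comm]
    rw [integrable_indicator_iff hS, IntegrableOn, Measure.restrict_restrict hS,
      Set.inter_eq_left.2 (hSA.trans hAsub)]
    exact integrableOn_const (hSμ hμ hSA)
  obtain ⟨hip, hil⟩ := hμp.integrable_approx hΩ hb hw hv hG
  obtain ⟨himp, himl⟩ := hμm.integrable_approx hΩ hb hw hv hG
  refine nonneg_of_forall_le_natCast_mul_add (m := m) (E := C.toReal
    + ∫ x in Ω, (approxLower Ω v x).toReal ∂μp - ∫ x in Ω, (approxUpper Ω v x).toReal ∂μm)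
    fun k hk => ?_
  have hk' : (0 : ℝ) < k := by exact_mod_cast hk
  have hwA : (fun x => v x + A.indicator (fun _ => σ * (k : ℝ)) x)
      = fun x => v x + σ * ((k : ℝ≥0) : ℝ) * A.indicator (fun _ => (1 : ℝ)) x := by
    ext x
    by_cases hx : x ∈ A <;> simp [hx]
  set w : Euc N → ℝ := fun x => v x + A.indicator (fun _ => σ * (k : ℝ)) x with hwdef
  have hext : (fun x => v x + σ * ((k : ℝ≥0) : ℝ) * A.indicator (fun _ => (1 : ℝ)) x)
      =ᵐ[volume] extend Ω u₀ w := by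
    rw [← hwA]
    filter_upwards [measure_eq_zero_iff_ae_notMem.1 (volume_frontier_eq_zero hΩ hlip)] with x hx
    rw [hΩ.frontier_eq] at hx
    unfold extend
    by_cases hxΩ : x ∈ Ω
    · rw [if_pos hxΩ]
    · rw [if_neg hxΩ, if_neg fun h => hx ⟨h, hxΩ⟩, hwdef]
      have hxA : x ∉ A := fun h => hxΩ (hAsub (subset_closure h))
      simp [hxA, hvu x hxΩ]
  have hTV := anisoTV_le hφ hβ hw hv.locallyIntegrable hG hGm isClosed_closure.measurableSet hG0
    h1A hρ hρK hσ k hext (closure Ω)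
  rw [← hT, ← hC] at hTV
  have hTV' : (anisoTV φ (extend Ω u₀ w) (closure Ω)).toReal ≤ k * T.toReal + C.toReal := by
    refine (ENNReal.toReal_mono (by finiteness) hTV).trans (le_of_eq ?_)
    rw [ENNReal.toReal_add (by finiteness) hCfin, ENNReal.toReal_mul]
    simp
  have hBV : MemBV Ω w := by
    classical
    have hpol := hw.hasPolarGradient_add hv.locallyIntegrable hG hGm
      isClosed_closure.measurableSet hG0 h1A hρ hρK hσ (k : ℝ≥0)
    rw [← hwA] at hpol
    refine hpol.memBV hΩ hb (hv.integrableOn.add ?_)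
    refine IntegrableOn.mono_set ?_ (subset_closure (s := Ω))
    have hi := (h1A.integrableOn_isCompact hb.isCompact_closure).const_mul (σ * k)
    refine hi.congr (Eventually.of_forall fun x => ?_)
    by_cases hx : x ∈ A <;> simp [hx]
  have hfun := hm w hBV
  unfold functional at hfun
  rw [hint hμp hS' hSA' hil fun x hx => approxLower_add_indicator hΩ hv0 hSA' (hlow k hk') hx,
    hint hμm hS hSA himp fun x hx => approxUpper_add_indicator hΩ hv0 hSA (hup k hk') hx] at hfun
  linarith

end AnisoBV

theorem proposition7p1 {N : ℕ} (hN : 1 ≤ N)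
    (Ω : Set (AnisoBV.Euc N)) (hΩ_open : IsOpen Ω) (hΩ_bdd : Bornology.IsBounded Ω)
    (hΩ_lip : AnisoBV.HasLipschitzBoundary Ω)
    (φ : AnisoBV.Euc N → AnisoBV.Euc N → ℝ) (hφ : AnisoBV.IsAdmissibleIntegrand φ)
    (μp μm : Measure (AnisoBV.Euc N))
    (hμp : AnisoBV.IsAdmissibleMeasure Ω μp) (hμm : AnisoBV.IsAdmissibleMeasure Ω μm)
    (u₀ : AnisoBV.Euc N → ℝ) (hu₀ : AnisoBV.MemW11 u₀)
    (h_below : ∃ m : ℝ, ∀ w : AnisoBV.Euc N → ℝ, AnisoBV.MemBV Ω w →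
      m ≤ AnisoBV.functional φ Ω u₀ μp μm w) :
    AnisoBV.SatisfiesIC φ Ω μm μp 1 ∧
      AnisoBV.SatisfiesIC (AnisoBV.mirrored φ) Ω μp μm 1 := by
  classical
  obtain ⟨m, hm⟩ := h_below
  have key {A : Set (AnisoBV.Euc N)} (hA : AnisoBV.CompactlyContained A Ω)
      {μ μ' : Measure (AnisoBV.Euc N)} (hμ : AnisoBV.IsAdmissibleMeasure Ω μ)
      (hμ' : AnisoBV.IsAdmissibleMeasure Ω μ') {T : ℝ≥0∞} (hT : T ≠ ⊤)
      (h : μ.real (AnisoBV.measureClosure A) ≤ T.toReal + μ'.real (AnisoBV.measureInterior A)) :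
      μ (AnisoBV.measureClosure A) - μ' (AnisoBV.measureInterior A) ≤ T := by
    have hfin {μ : Measure (AnisoBV.Euc N)} (hμ : AnisoBV.IsAdmissibleMeasure Ω μ) :
        μ (closure A) < ⊤ := hμ.lt_top_of_isCompact _ hA.1 hA.2
    have h1 : μ (AnisoBV.measureClosure A) ≠ ⊤ :=
      ((measure_mono (AnisoBV.measureClosure_subset_closure A)).trans_lt (hfin hμ)).ne
    have h2 : μ' (AnisoBV.measureInterior A) ≠ ⊤ :=
      ((measure_mono ((AnisoBV.measureInterior_subset_measureClosure A).trans
        (AnisoBV.measureClosure_subset_closure A))).trans_lt (hfin hμ')).ne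
    rw [tsub_le_iff_right, ← ENNReal.toReal_le_toReal h1 (by finiteness), ENNReal.toReal_add hT h2]
    exact h
  constructor
  · intro A hA hAΩ
    have hcl := AnisoBV.measureClosure_subset_closure A
    have hint := (AnisoBV.measureInterior_subset_measureClosure A).trans hcl
    rw [ENNReal.coe_one, one_mul, ← tsub_le_iff_right]
    refine le_iInf₂ fun ρ ν => le_iInf fun hρ => ?_
    obtain ⟨hT, h⟩ := AnisoBV.isoperimetric_of_bddBelow hΩ_open hΩ_bdd hΩ_lip hφ hμp hμm hu₀ hm hA
      hAΩ hρ.2 (σ := 1) (by simp) (AnisoBV.measurableSet_measureClosure A)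
      (AnisoBV.measurableSet_measureInterior hA) hcl hint
      (fun k hk x hx => by
        simpa using! AnisoBV.approxUpper_indicator_pos (A := A) hΩ_open hx hk)
      (fun k hk x hx => by
        simpa using! AnisoBV.approxLower_indicator_pos (A := A) hΩ_open hx hk)
    simp only [one_smul] at hT h
    rw [Measure.restrict_univ]
    exact key hAΩ hμm hμp hT (by linarith)
  · intro A hA hAΩ
    have hcl := AnisoBV.measureClosure_subset_closure A
    have hint := (AnisoBV.measureInterior_subset_measureClosure A).trans hcl
    rw [ENNReal.coe_one, one_mul, ← tsub_le_iff_right]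
    refine le_iInf₂ fun ρ ν => le_iInf fun hρ => ?_
    obtain ⟨hT, h⟩ := AnisoBV.isoperimetric_of_bddBelow hΩ_open hΩ_bdd hΩ_lip hφ hμp hμm hu₀ hm hA
      hAΩ hρ.2 (σ := -1) (by simp) (AnisoBV.measurableSet_measureInterior hA)
      (AnisoBV.measurableSet_measureClosure A) hint hcl
      (fun k hk x hx => by
        simpa using! AnisoBV.approxUpper_indicator_neg hA hΩ_open hx (c := -1 * k) (by linarith))
      (fun k hk x hx => by
        simpa using! AnisoBV.approxLower_indicator_neg hA hΩ_open hx (c := -1 * k) (by linarith))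
    simp only [neg_smul, one_smul] at hT h
    rw [Measure.restrict_univ]
    exact key hAΩ hμp hμm hT (by simp only [AnisoBV.mirrored]; linarith)
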